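/- **Conventions.** All vector spaces are real. $(E,\tau)$ is a Hausdorff locally convex space (lcs) with continuous dual $E^*$; for $S\subseteq E$ and $M\subseteq E^*$ put $S^\circ=\{\varphi\in E^*: |\varphi(x)|\le 1\ \forall x\in S\}$ and $M^\circ=\{x\in E: |\varphi(x)|\le 1\ \forall\varphi\in M\}$. For $M\subseteq E^*$ with the weak-star topology let $r_M\colon E\to C(M)$, $r_M(x)(\varphi)=\varphi(x)$. Compact spaces are Hausdorff, and $C(K)$ is the Banach space of continuous real functions on $K$ with the supremum norm. **Bornologies.** A *convex vector bornology* on a vector space is a family of subsets which covers the space and is closed under passing to subsets, finite unions, sums, scalar multiples, balanced hulls and convex hulls. It is *separated* if $\{0\}$ is the only linear subspace belonging to it. A *bornological class* $\mathfrak B$ assigns to every compact space $K$ a separated convex vector bornology $\mathfrak B_K$ on $C(K)$ such that: 1. every member of $\mathfrak B_K$ is norm bounded; 2. for every continuous $\alpha\colon K_1\to K_2$, if $A\in\mathfrak B_{K_2}$ then $A\circ\alpha\in\mathfrak B_{K_1}$, and, when $\alpha$ is surjective, $A\circ\alpha\in\mathfrak B_{K_1}$ implies $A\in\mathfrak B_{K_2}$;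 3. if $A\in\mathfrak B_K$ then $A^{\circ\circ}\in\mathfrak B_K$, where the bipolar is taken in the duality of $C(K)$ with $C(K)^*$. It is *polarly compatible* if for every compact $K$ and $A\in\mathfrak B_K$, the set $A$, regarded as a family of functions on the weak-star compact unit ball $B_{C(K)^*}$, belongs to $\mathfrak B_{B_{C(K)^*}}$. **Small and co-small.** A locally convex topology $\sigma$ on $E$ is *$\mathfrak B$-small* if $r_M(B)\in\mathfrak B_M$ for every $\sigma$-bounded $B\subseteq E$ and every equicontinuous weak-star compact $M\subseteq(E,\sigma)^*$. An equicontinuous $M\subseteq E^*$ is *co-$\mathfrak B$-small* if $r_{\overline M}(A)\in\mathfrak B_{\overline M}$ for every bounded $A\subseteq E$, where $\overline M$ is the weak-star closure of $M$. **Tameness.** A bounded family $F$ of real functions on a set $X$ is *tame* if it contains no independent sequence, where $(f_n)_{n\in\mathbb N}$ is *independent* if there are reals $a<b$ such that $$\bigcap_{n\in P}f_n^{-1}(-\infty,a)\cap\bigcap_{n\in Q}f_n^{-1}(b,\infty)\neq\emptyset$$ for all finite disjoint $P,Q\subseteq\mathbb N$. *Tame* topologies and *co-tame* sets are the $\mathfrak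 B$-small topologies and the co-$\mathfrak B$-small sets for the assignment $\mathfrak B_K=\{\text{tame families in } C(K)\}$. **Theorem.** Let $(E,\tau)$ be a Hausdorff locally convex space, let $\tau_w$ be its weak topology and let $\tau_\mu$ be its Mackey topology, i.e. the topology of uniform convergence on the absolutely convex weak-star compact subsets of $E^*$. (a) The co-tame subsets of $E^*$ form a convex vector bornology that is closed under weak-star closures. The sets $M^\circ$, with $M$ co-tame, form a basis of neighbourhoods of $0$ for the polar topology $\tau_{tame}$ of this bornology (the topology of uniform convergence on co-tame sets). The topology $\tau_{tame}$ is Hausdorff and locally convex, it is tame and coarser than $\tau$, and it is the strongest such topology: every tame locally convex topology on $E$ that is coarser than $\tau$ is coarser than $\tau_{tame}$. Moreover $$\tau_w\subseteq\tau_{tame}\subseteq\tau\subseteq\tau_\mu .$$ (b) More generally, let $\mathfrak B$ be any polarly compatible bornological class. Then all of (a) holds with "co-$\mathfrak B$-small" in place of "co-tame", "$\mathfrak B$-small" in place of "tame", and $\tau_{\mathfrak B}$, the polar topology of the co-$\mathfrak B$-small subsets of $E^*$, in place of $\tau_{tame}$. In particular $\tau_{\mathfrak B}$ is the strongest $\mathfrak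 B$-small locally convex topology on $E$ coarser than $\tau$, and $\tau_w\subseteq\tau_{\mathfrak B}\subseteq\tau\subseteq\tau_\mu$. -/

import Mathlib

open Set Topology
open scoped Pointwise

universe u

/-! ### Polars and restriction maps -/

section Duality

variable {E : Type u} [AddCommGroup E] [Module ℝ E] [TopologicalSpace E]

/-- The polar in `E*` of a subset of `E`. -/
def polarInDual (S : Set E) : Set (WeakDual ℝ E) :=
  {φ | ∀ x ∈ S, |φ x| ≤ 1}

/-- The polar in `E` of a subset of `E*`. -/
def polarInSpace (M : Set (WeakDual ℝ E)) : Set E :=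
  {x | ∀ φ ∈ M, |φ x| ≤ 1}

/-- Equicontinuity of a set of continuous linear functionals. -/
def IsEquicontinuousSet (M : Set (WeakDual ℝ E)) : Prop :=
  Equicontinuous (fun (φ : M) (x : E) => (φ : WeakDual ℝ E) x)

/-- The restriction operator `r_M : E → C(M)`, `r_M(x)(φ) = φ(x)`, where `M ⊆ E*` carries the
weak-star topology. -/
noncomputable def restrictionMap (M : Set (WeakDual ℝ E)) (x : E) : C(M, ℝ) where
  toFun φ := (φ : WeakDual ℝ E) x
  continuous_toFun := (WeakDual.eval_continuous x).comp continuous_subtype_val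

end Duality

/-! ### Bornologies on a vector space -/

section Bornologies

variable {V : Type u} [AddCommGroup V] [Module ℝ V]

/-- A convex vector bornology on a real vector space, as the family of its bounded sets. -/
structure IsConvexVectorBornology (𝓑 : Set (Set V)) : Prop where
  covers : ⋃₀ 𝓑 = univ
  subset_mem : ∀ A ∈ 𝓑, ∀ B ⊆ A, B ∈ 𝓑
  union_mem : ∀ A ∈ 𝓑, ∀ B ∈ 𝓑, A ∪ B ∈ 𝓑
  add_mem : ∀ A ∈ 𝓑, ∀ B ∈ 𝓑, A + B ∈ 𝓑
  smul_mem : ∀ (c : ℝ), ∀ A ∈ 𝓑, c • A ∈ 𝓑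
  balancedHull_mem : ∀ A ∈ 𝓑, balancedHull ℝ A ∈ 𝓑
  convexHull_mem : ∀ A ∈ 𝓑, convexHull ℝ A ∈ 𝓑

/-- A bornology is separated if the only linear subspace belonging to it is `{0}`. -/
def IsSeparatedBornology (𝓑 : Set (Set V)) : Prop :=
  ∀ S : Submodule ℝ V, (S : Set V) ∈ 𝓑 → S = ⊥

/-- A bornology is saturated if the closures of its members are again members. -/
def IsSaturatedBornology [TopologicalSpace V] (𝓑 : Set (Set V)) : Prop :=
  ∀ A ∈ 𝓑, closure A ∈ 𝓑

end Bornologies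

/-! ### Bornological classes -/

/-- An assignment of a family of subsets of `C(K)` to every compact Hausdorff space `K`. -/
abbrev FunctionClass : Type (u + 1) :=
  ∀ (K : Type u) [TopologicalSpace K] [CompactSpace K] [T2Space K], Set (Set C(K, ℝ))

/-- The family `A ∘ α = {f ∘ α : f ∈ A}`. -/
def pullbackFamily {K L : Type u} [TopologicalSpace K] [TopologicalSpace L]
    (α : C(K, L)) (A : Set C(L, ℝ)) : Set C(K, ℝ) :=
  (fun f : C(L, ℝ) => f.comp α) '' A

/-- Bornological classes. -/
structure IsBornologicalClass (𝔅 : FunctionClass.{u}) : Prop where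
  convexVectorBornology : ∀ (K : Type u) [TopologicalSpace K] [CompactSpace K] [T2Space K],
    IsConvexVectorBornology (𝔅 K)
  separated : ∀ (K : Type u) [TopologicalSpace K] [CompactSpace K] [T2Space K],
    IsSeparatedBornology (𝔅 K)
  bounded : ∀ (K : Type u) [TopologicalSpace K] [CompactSpace K] [T2Space K],
    ∀ A ∈ 𝔅 K, Bornology.IsBounded A
  comp_mem : ∀ (K L : Type u) [TopologicalSpace K] [CompactSpace K] [T2Space K]
    [TopologicalSpace L] [CompactSpace L] [T2Space L] (α : C(K, L)) (A : Set C(L, ℝ)),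
    A ∈ 𝔅 L → pullbackFamily α A ∈ 𝔅 K
  mem_of_comp_mem : ∀ (K L : Type u) [TopologicalSpace K] [CompactSpace K] [T2Space K]
    [TopologicalSpace L] [CompactSpace L] [T2Space L] (α : C(K, L)) (A : Set C(L, ℝ)),
    Function.Surjective α → pullbackFamily α A ∈ 𝔅 K → A ∈ 𝔅 L
  bipolar_mem : ∀ (K : Type u) [TopologicalSpace K] [CompactSpace K] [T2Space K],
    ∀ A ∈ 𝔅 K, polarInSpace (polarInDual A) ∈ 𝔅 K

/-- The closed unit ball of the dual Banach space `C(K)*`, with the weak-star topology. -/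
def dualUnitBall (K : Type u) [TopologicalSpace K] [CompactSpace K] :
    Set (WeakDual ℝ C(K, ℝ)) :=
  {φ | ∀ f : C(K, ℝ), |φ f| ≤ ‖f‖}

theorem isCompact_weakDual_unitBall (V : Type u) [NormedAddCommGroup V] [NormedSpace ℝ V] :
    IsCompact {φ : WeakDual ℝ V | ∀ f : V, |φ f| ≤ ‖f‖} := by
  have h : {φ : WeakDual ℝ V | ∀ f : V, |φ f| ≤ ‖f‖} =
      WeakDual.toStrongDual ⁻¹' Metric.closedBall 0 1 := by
    ext φ
    rw [Set.mem_preimage, mem_closedBall_zero_iff]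
    constructor
    · intro hφ
      exact ContinuousLinearMap.opNorm_le_bound _ zero_le_one fun f => by
        rw [one_mul]; exact hφ f
    · intro hφ f
      have h1 := ContinuousLinearMap.le_of_opNorm_le _ hφ f
      rw [one_mul] at h1
      exact h1
  rw [h]
  exact WeakDual.isCompact_closedBall (𝕜 := ℝ) 0 1

instance dualUnitBall_compactSpace (K : Type u) [TopologicalSpace K] [CompactSpace K] :
    CompactSpace (dualUnitBall K) :=
  isCompact_iff_compactSpace.mp (isCompact_weakDual_unitBall C(K, ℝ))

/-- Polar compatibility: if `A ∈ 𝔅_K`, then `A`, regarded as a family of functions on the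
weak-star compact unit ball of `C(K)*`, belongs to the class of that ball. -/
def IsPolarlyCompatible (𝔅 : FunctionClass.{u}) : Prop :=
  ∀ (K : Type u) [TopologicalSpace K] [CompactSpace K] [T2Space K],
    ∀ A ∈ 𝔅 K, restrictionMap (dualUnitBall K) '' A ∈ 𝔅 (dualUnitBall K)

/-! ### Tame families -/

/-- (Combinatorially) independent sequences of real functions. -/
def IsIndependentSequence {X : Type u} (f : ℕ → X → ℝ) : Prop :=
  ∃ a b : ℝ, a < b ∧ ∀ P M : Finset ℕ, Disjoint P M →
    ∃ x : X, (∀ n ∈ P, f n x < a) ∧ (∀ n ∈ M, b < f n x)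

/-- Tame families: bounded families of real functions containing no independent sequence. -/
def IsTameFamily {X : Type u} (F : Set (X → ℝ)) : Prop :=
  (∃ C : ℝ, ∀ f ∈ F, ∀ x, |f x| ≤ C) ∧
    ∀ f : ℕ → X → ℝ, (∀ n, f n ∈ F) → ¬ IsIndependentSequence f

/-- The class `[T]` of tame families of continuous functions. -/
def tameClass : FunctionClass.{u} :=
  fun K _ _ _ => {A | IsTameFamily ((fun f : C(K, ℝ) => (f : K → ℝ)) '' A)}

/-! ### Small subsets, small topologies, co-small subsets of the dual -/

section Small

variable {E : Type u} [AddCommGroup E] [Module ℝ E]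

/-- `B` is a `𝔅`-small subset of `(E, σ)`: it is bounded, and `r_M(B) ∈ 𝔅_M` for every
equicontinuous weak-star compact `M ⊆ (E, σ)*`. -/
def IsSmallSet (𝔅 : FunctionClass.{u}) (σ : TopologicalSpace E) (B : Set E) : Prop :=
  Bornology.IsVonNBounded ℝ B ∧
    ∀ (M : Set (WeakDual ℝ E)) [CompactSpace M], IsEquicontinuousSet M →
      restrictionMap M '' B ∈ 𝔅 M

/-- `(E, σ)` is `𝔅`-small: all its bounded subsets are. -/
def IsSmallTopology (𝔅 : FunctionClass.{u}) (σ : TopologicalSpace E) : Prop :=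
  ∀ B : Set E, Bornology.IsVonNBounded ℝ B → IsSmallSet 𝔅 σ B

/-- `M ⊆ (E, τ)*` is co-`𝔅`-small with respect to `A ⊆ E`: it is equicontinuous and
`r(A) ∈ 𝔅_K`, where `K` is the weak-star closure of `M` (always compact, by the
Alaoglu-Bourbaki theorem). -/
def IsCoSmallWrt (𝔅 : FunctionClass.{u}) (τ : TopologicalSpace E) (A : Set E)
    (M : Set (WeakDual ℝ E)) : Prop :=
  IsEquicontinuousSet M ∧ ∃ _ : CompactSpace (closure M),
    restrictionMap (closure M) '' A ∈ 𝔅 (closure M)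

/-- The family of the co-`𝔅`-small subsets of `(E, τ)*`. -/
def coSmall (𝔅 : FunctionClass.{u}) (τ : TopologicalSpace E) : Set (Set (WeakDual ℝ E)) :=
  {M | ∀ A : Set E, Bornology.IsVonNBounded ℝ A → IsCoSmallWrt 𝔅 τ A M}

/-! ### Locally convex topologies -/

/-- `σ` is a (not necessarily Hausdorff) locally convex vector space topology on `E`. -/
structure IsLocallyConvexTopology (σ : TopologicalSpace E) : Prop where
  isTopologicalAddGroup : IsTopologicalAddGroup E
  continuousSMul : ContinuousSMul ℝ E
  locallyConvexSpace : LocallyConvexSpace ℝ E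

/-- The polar topology on `E` given by a family `𝓑` of subsets of `(E, τ)*`: the topology of
uniform convergence on the members of `𝓑`. -/
@[reducible] noncomputable def polarTopology (τ : TopologicalSpace E) (𝓑 : Set (Set (WeakDual ℝ E))) :
    TopologicalSpace E :=
  TopologicalSpace.induced
    (fun x => UniformOnFun.ofFun 𝓑 (fun φ : WeakDual ℝ E => φ x))
    (UniformOnFun.topologicalSpace (WeakDual ℝ E) ℝ 𝓑)

/-- The weak topology of `(E, τ)`, as a topology on `E`. -/
@[reducible] noncomputable def weakTopology (τ : TopologicalSpace E) : TopologicalSpace E :=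
  TopologicalSpace.induced (toWeakSpace ℝ E) inferInstance

/-- The Mackey topology of `(E, τ)`: the topology of uniform convergence on the absolutely convex
weak-star compact subsets of `E*`. -/
@[reducible] noncomputable def mackeyTopology (τ : TopologicalSpace E) : TopologicalSpace E :=
  polarTopology τ {M | IsCompact M ∧ AbsConvex ℝ M}

/-- `s` is the strongest locally convex `𝔅`-small topology on `E` coarser than `τ`. In Mathlib
`τ ≤ s` means that `s` is coarser than `τ`. -/
structure IsStrongestSmallTopology (𝔅 : FunctionClass.{u}) (τ s : TopologicalSpace E) :
    Prop where
  locallyConvex : IsLocallyConvexTopology s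
  small : IsSmallTopology 𝔅 s
  coarser : τ ≤ s
  strongest : ∀ σ : TopologicalSpace E,
    IsLocallyConvexTopology σ → IsSmallTopology 𝔅 σ → τ ≤ σ → s ≤ σ

/-- The polar topology of the co-`𝔅`-small subsets of `(E, τ)*`. -/
@[reducible] noncomputable def coSmallTopology (𝔅 : FunctionClass.{u}) (τ : TopologicalSpace E) : TopologicalSpace E :=
  polarTopology τ (coSmall 𝔅 τ)

/-- The tame topology: the polar topology of the co-tame subsets of `(E, τ)*`. -/
@[reducible] noncomputable def tameTopology (τ : TopologicalSpace E) : TopologicalSpace E :=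
  coSmallTopology tameClass τ

end Small

/-! ### Polars, and the Alaoglu–Bourbaki, bipolar and Mackey theorems -/

section Polars

open Filter

variable {E : Type u} [AddCommGroup E] [Module ℝ E] [TopologicalSpace E]

/-! Co-smallness can be tested on parametrizations: an equicontinuous set is co-small as soon as it
lies in the image of a continuous map from a compact `L` to `E*` along which the evaluations of each
bounded set belong to the class of `L` (`mem_coSmall_of_subset_range`). Scalar multiples and sums of
co-small sets are then parametrized by `closure M` and `closure M × closure N`. Polar compatibility
enters through bipolars: by Hahn–Banach, `M°°` is covered by the dual unit ball of `C(closure M)`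
under the adjoint of the restriction operator (`bipolar_mem_coSmall`). Unions and hulls follow.

The polar topology is small because its equicontinuous sets lie in bipolars of co-small sets, while
its bounded sets are `τ`-bounded by Mackey's theorem. It is the strongest such topology because, for
a small `σ` coarser than `τ`, the polar of each `σ`-neighbourhood of zero is co-small, and these
polars determine `σ` by the bipolar theorem.

The tame case needs tame families to form a polarly compatible bornological class. The key is
`mem_tameClass_iff`: tame means bounded and totally bounded in `L¹(μ)` for all finite Borel measures
`μ` on `K`. A bounded `L¹`-separated sequence has an independent subsequence
(`exists_independent_subsequence`). Conversely, a sequence independent on the whole dual unit ball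
is separated in some `L¹(μ)` (`exists_measure_separated_of_independent`), by averaging over sign
patterns, Hahn–Banach separation and Riesz representation. Total boundedness survives closed
absolutely convex hulls, which handles bipolars; working on the whole ball gives polar
compatibility. -/

theorem polarInSpace_anti {M N : Set (WeakDual ℝ E)} (h : M ⊆ N) :
    polarInSpace N ⊆ polarInSpace M := fun _ hx φ hφ => hx φ (h hφ)

theorem polarInDual_anti {S T : Set E} (h : S ⊆ T) : polarInDual T ⊆ polarInDual S :=
  fun _ hφ x hx => hφ x (h hx)

theorem subset_polarInSpace_polarInDual (S : Set E) : S ⊆ polarInSpace (polarInDual S) :=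
  fun x hx _ hφ => hφ x hx

theorem subset_polarInDual_polarInSpace (M : Set (WeakDual ℝ E)) :
    M ⊆ polarInDual (polarInSpace M) :=
  fun φ hφ _ hx => hx φ hφ

theorem absConvex_polarInDual [ContinuousAdd E] [ContinuousConstSMul ℝ E] (S : Set E) :
    AbsConvex ℝ (polarInDual S) := by
  refine ⟨balanced_iff_smul_mem.2 fun {a} ha φ hφ x hx => ?_, fun φ hφ ψ hψ s t hs ht hst x hx => ?_⟩
  · change |a * φ x| ≤ 1
    rw [abs_mul]
    exact mul_le_one₀ ha (abs_nonneg _) (hφ x hx)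
  · change |s * φ x + t * ψ x| ≤ 1
    have h1 := abs_le.1 (hφ x hx)
    have h2 := abs_le.1 (hψ x hx)
    rw [abs_le]
    constructor <;> nlinarith

theorem mem_polarInSpace_smul [ContinuousConstSMul ℝ E] {M : Set (WeakDual ℝ E)} {c : ℝ} {x : E} :
    x ∈ polarInSpace (c • M) ↔ c • x ∈ polarInSpace M := by
  constructor
  · intro h φ hφ
    rw [map_smul]
    exact h _ (smul_mem_smul_set hφ)
  · rintro h _ ⟨φ, hφ, rfl⟩
    have := h φ hφ
    rw [map_smul] at this
    exact this

theorem isEquicontinuousSet_of_polarInSpace_mem_nhds [IsTopologicalAddGroup E]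
    [ContinuousSMul ℝ E] {M : Set (WeakDual ℝ E)} (h : polarInSpace M ∈ 𝓝 (0 : E)) :
    IsEquicontinuousSet M := by
  intro x₀
  rw [Metric.equicontinuousAt_iff_right]
  intro ε hε
  -- Scaling by `2 / ε` yields the bound `ε / 2`, which leaves room for the strict inequality.
  have ht : Tendsto (fun y : E => (2 / ε) • (x₀ - y)) (𝓝 x₀) (𝓝 0) := by
    have : Continuous fun y : E => (2 / ε) • (x₀ - y) := by fun_prop
    simpa using this.tendsto x₀
  filter_upwards [ht h] with y hy φ
  have h1 := hy φ φ.2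
  rw [map_smul, map_sub, smul_eq_mul, abs_mul, abs_of_pos (by positivity)] at h1
  rw [Real.dist_eq]
  have h2 : |(φ : WeakDual ℝ E) x₀ - (φ : WeakDual ℝ E) y| ≤ ε / 2 := by
    rw [le_div_iff₀ two_pos]
    rw [div_mul_eq_mul_div, div_le_one hε] at h1
    linarith
  linarith

theorem IsEquicontinuousSet.polarInSpace_mem_nhds {M : Set (WeakDual ℝ E)}
    (h : IsEquicontinuousSet M) : polarInSpace M ∈ 𝓝 (0 : E) := by
  have := Metric.equicontinuousAt_iff_right.1 (h 0) 1 one_pos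
  filter_upwards [this] with y hy φ hφ
  have h1 := hy ⟨φ, hφ⟩
  rw [Real.dist_eq, map_zero, zero_sub, abs_neg] at h1
  exact h1.le

theorem exists_bound_of_mem_nhds_zero [ContinuousSMul ℝ E] {U : Set E} (hU : U ∈ 𝓝 (0 : E))
    (x : E) : ∃ r : ℝ, 0 < r ∧ r • x ∈ U := by
  have ht : Tendsto (fun r : ℝ => r • x) (𝓝[>] 0) (𝓝 0) := by
    have : Continuous fun r : ℝ => r • x := by fun_prop
    have := this.tendsto 0
    rw [zero_smul] at this
    exact this.mono_left nhdsWithin_le_nhds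
  obtain ⟨r, hr, hr'⟩ := (Filter.Eventually.and (ht.eventually hU) self_mem_nhdsWithin).exists
  exact ⟨r, hr', hr⟩

/-- The Alaoglu–Bourbaki theorem. -/
theorem isCompact_polarInDual [IsTopologicalAddGroup E] [ContinuousSMul ℝ E] {U : Set E}
    (hU : U ∈ 𝓝 (0 : E)) : IsCompact (polarInDual U) := by
  have hemb : IsInducing (fun (φ : WeakDual ℝ E) (x : E) => φ x) := ⟨rfl⟩
  rw [hemb.isCompact_iff]
  choose r hr hrU using exists_bound_of_mem_nhds_zero hU
  have hK : IsCompact (Set.univ.pi fun x : E => Icc (-(r x)⁻¹) (r x)⁻¹) :=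
    isCompact_univ_pi fun x => isCompact_Icc
  -- A linear function bounded by one on `U` is automatically continuous, so the image is cut out of
  -- the product by closed pointwise conditions alone.
  have hset : (fun (φ : WeakDual ℝ E) (x : E) => φ x) '' polarInDual U =
      {f : E → ℝ | (∀ x y, f (x + y) = f x + f y) ∧ (∀ (c : ℝ) x, f (c • x) = c * f x) ∧
        ∀ x ∈ U, |f x| ≤ 1} := by
    ext f
    constructor
    · rintro ⟨φ, hφ, rfl⟩
      exact ⟨fun x y => map_add φ x y, fun c x => map_smul φ c x, hφ⟩
    · rintro ⟨hadd, hsmul, hle⟩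
      let g : E →ₗ[ℝ] ℝ := { toFun := f, map_add' := hadd, map_smul' := hsmul }
      have hg : Continuous g := by
        refine continuous_of_continuousAt_zero g ?_
        rw [ContinuousAt, map_zero, Metric.tendsto_nhds]
        intro ε hε
        have ht : Tendsto (fun y : E => (2 / ε) • y) (𝓝 0) (𝓝 0) := by
          have : Continuous fun y : E => (2 / ε) • y := by fun_prop
          simpa using this.tendsto 0
        filter_upwards [ht hU] with y hy
        have h1 := hle _ hy
        rw [hsmul, abs_mul, abs_of_pos (by positivity), div_mul_eq_mul_div, div_le_one hε] at h1
        rw [Real.dist_eq, sub_zero]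
        change |f y| < ε
        linarith [abs_nonneg (f y)]
      exact ⟨(⟨g, hg⟩ : E →L[ℝ] ℝ), hle, rfl⟩
  rw [hset]
  refine hK.of_isClosed_subset ?_ ?_
  · simp only [ofPred_and, ofPred_forall]
    refine IsClosed.inter ?_ (IsClosed.inter ?_ ?_)
    · exact isClosed_iInter fun x => isClosed_iInter fun y =>
        isClosed_eq (by fun_prop) (by fun_prop)
    · exact isClosed_iInter fun x => isClosed_iInter fun y =>
        isClosed_eq (by fun_prop) (by fun_prop)
    · exact isClosed_iInter fun x => isClosed_iInter fun _ =>
        isClosed_le (by fun_prop) (by fun_prop)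
  · rintro f ⟨-, hsmul, hle⟩ x -
    have h1 := hle _ (hrU x)
    rw [hsmul, abs_mul, abs_of_pos (hr x)] at h1
    rw [mem_Icc, ← abs_le, inv_eq_one_div, le_div_iff₀ (hr x)]
    linarith

theorem isEquicontinuousSet_polarInDual [IsTopologicalAddGroup E] [ContinuousSMul ℝ E]
    {U : Set E} (hU : U ∈ 𝓝 (0 : E)) : IsEquicontinuousSet (polarInDual U) :=
  isEquicontinuousSet_of_polarInSpace_mem_nhds
    (mem_of_superset hU (subset_polarInSpace_polarInDual U))

/-- The bipolar theorem. -/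
theorem polarInSpace_polarInDual_subset_closedAbsConvexHull [IsTopologicalAddGroup E]
    [ContinuousSMul ℝ E] [LocallyConvexSpace ℝ E] {S : Set E} (hS : S.Nonempty) :
    polarInSpace (polarInDual S) ⊆ closedAbsConvexHull ℝ S := by
  intro x hx
  by_contra hxS
  have hac : AbsConvex ℝ (closedAbsConvexHull ℝ S) := absConvex_convexClosedHull
  obtain ⟨f, u, hf, hfx⟩ := geometric_hahn_banach_closed_point hac.2
    isClosed_closedAbsConvexHull hxS
  obtain ⟨s, hs⟩ := hS
  have hlt : ∀ a ∈ S, |f a| < u := by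
    intro a ha
    have ha' := subset_closedAbsConvexHull (𝕜 := ℝ) ha
    have h1 := hf _ ha'
    have h2 := hf _ (hac.1.neg_mem_iff.2 ha')
    rw [map_neg] at h2
    exact abs_lt.2 ⟨by linarith, h1⟩
  have hu : 0 < u := (abs_nonneg _).trans_lt (hlt s hs)
  have := hx (u⁻¹ • f : E →L[ℝ] ℝ) fun a ha => by
    change |u⁻¹ * f a| ≤ 1
    rw [abs_mul, abs_of_pos (inv_pos.2 hu), inv_mul_le_iff₀ hu, mul_one]
    exact (hlt a ha).le
  change |u⁻¹ * f x| ≤ 1 at this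
  rw [abs_mul, abs_of_pos (inv_pos.2 hu), inv_mul_le_iff₀ hu, mul_one] at this
  linarith [le_abs_self (f x)]

/-- A closed absolutely convex neighbourhood equals its bipolar, so the polars of neighbourhoods
determine the topology. -/
theorem exists_mem_nhds_polarInSpace_polarInDual_subset [IsTopologicalAddGroup E]
    [ContinuousSMul ℝ E] [LocallyConvexSpace ℝ E] {U : Set E} (hU : U ∈ 𝓝 (0 : E)) :
    ∃ V ∈ 𝓝 (0 : E), polarInSpace (polarInDual V) ⊆ U := by
  obtain ⟨V, ⟨hV, hVc, hVac⟩, hVU⟩ := (nhds_hasBasis_absConvex_closed ℝ E).mem_iff.1 hU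
  refine ⟨V, hV, (polarInSpace_polarInDual_subset_closedAbsConvexHull ⟨0, mem_of_mem_nhds hV⟩).trans
    ((closedAbsConvexHull_min Subset.rfl hVac hVc).trans hVU)⟩

/-- Pointwise bounded families of vectors are uniformly bounded on compact convex subsets of the
dual. -/
theorem exists_uniform_bound_of_isCompact_convex [IsTopologicalAddGroup E] [ContinuousSMul ℝ E]
    {K : Set (WeakDual ℝ E)} (hK : IsCompact K) (hconv : Convex ℝ K) {B : Set E}
    (hB : ∀ φ : WeakDual ℝ E, ∃ C : ℝ, ∀ x ∈ B, |φ x| ≤ C) :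
    ∃ C : ℝ, ∀ φ ∈ K, ∀ x ∈ B, |φ x| ≤ C := by
  obtain rfl | hne := K.eq_empty_or_nonempty
  · exact ⟨0, by simp⟩
  have : CompactSpace K := isCompact_iff_compactSpace.1 hK
  have : Nonempty K := hne.to_subtype
  -- Baire category in the compact space `K`: some `F n` has an interior point `φ₀`.
  let F : ℕ → Set K := fun n => {φ | ∀ x ∈ B, |(φ : WeakDual ℝ E) x| ≤ n}
  have hF : ∀ n, IsClosed (F n) := by
    intro n
    simp only [F, ofPred_forall]
    exact isClosed_iInter fun x => isClosed_iInter fun _ => isClosed_le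
      ((WeakDual.eval_continuous x).comp continuous_subtype_val).abs continuous_const
  have hU : ⋃ n, F n = univ := by
    refine eq_univ_of_forall fun φ => ?_
    obtain ⟨C, hC⟩ := hB φ
    obtain ⟨n, hn⟩ := exists_nat_ge C
    exact mem_iUnion.2 ⟨n, fun x hx => (hC x hx).trans hn⟩
  obtain ⟨n, φ₀, hφ₀⟩ := nonempty_interior_of_iUnion_of_closed hF hU
  -- Contract `K` towards `φ₀`. By the tube lemma a single `t > 0` moves all of `K` into the
  -- interior of `F n`.
  let I := Icc (0 : ℝ) 1
  let h : I × K → K := fun p => ⟨(1 - (p.1 : ℝ)) • (φ₀ : WeakDual ℝ E) + (p.1 : ℝ) • p.2,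
    hconv φ₀.2 p.2.2 (by linarith [p.1.2.2]) p.1.2.1 (by ring)⟩
  have hcont : Continuous h := by
    refine Continuous.subtype_mk ?_ _
    fun_prop
  have hO : IsOpen (h ⁻¹' interior (F n)) := isOpen_interior.preimage hcont
  obtain ⟨u, v, hu, -, h0u, hv, huv⟩ := generalized_tube_lemma
    (isCompact_singleton (x := (0 : I))) (isCompact_univ (X := K)) hO (by
      rintro ⟨t, φ⟩ ⟨ht, -⟩
      rw [mem_singleton_iff] at ht
      subst ht
      have : h (0, φ) = φ₀ := by
        apply Subtype.ext
        simp [h]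
      rw [mem_preimage, this]
      exact hφ₀)
  have hu0 : u ∈ 𝓝 (0 : I) := hu.mem_nhds (h0u rfl)
  obtain ⟨ε, hε, hεu⟩ := Metric.mem_nhds_iff.1 hu0
  let t : I := ⟨min 1 (ε / 2), by positivity, min_le_left _ _⟩
  have ht : 0 < (t : ℝ) := by change 0 < min 1 (ε / 2); positivity
  have htu : t ∈ u := hεu (by
    rw [Metric.mem_ball, Subtype.dist_eq, Real.dist_eq]
    change |(t : ℝ) - 0| < ε
    rw [sub_zero, abs_of_pos ht]
    exact (min_le_right _ _).trans_lt (by linarith))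
  -- Solving `(1 - t) φ₀ + t φ ∈ F n` for `φ` costs `n` once for the combination and once for `φ₀`.
  refine ⟨(2 * n) / t, fun φ hφ x hx => ?_⟩
  have hmem : h (t, ⟨φ, hφ⟩) ∈ F n := interior_subset (huv ⟨htu, hv (mem_univ _)⟩)
  have h1 : |(1 - (t : ℝ)) * (φ₀ : WeakDual ℝ E) x + t * φ x| ≤ n := hmem x hx
  have h2 : |(φ₀ : WeakDual ℝ E) x| ≤ n := interior_subset hφ₀ x hx
  rw [le_div_iff₀ ht]
  have h3 : |φ x| * t = |t * φ x| := by rw [abs_mul, abs_of_pos ht, mul_comm]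
  rw [h3]
  have ht1 : (t : ℝ) ≤ 1 := t.2.2
  have h4 : |(1 - (t : ℝ)) * (φ₀ : WeakDual ℝ E) x| ≤ n := by
    rw [abs_mul, abs_of_nonneg (by linarith)]
    nlinarith [abs_nonneg ((φ₀ : WeakDual ℝ E) x)]
  calc |t * φ x| = |((1 - (t : ℝ)) * (φ₀ : WeakDual ℝ E) x + t * φ x)
        - (1 - (t : ℝ)) * (φ₀ : WeakDual ℝ E) x| := by congr 1; ring
    _ ≤ _ := abs_sub _ _
    _ ≤ 2 * n := by linarith

/-- Mackey's theorem: weakly bounded subsets of a locally convex space are bounded. -/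
theorem isVonNBounded_of_forall_dual [IsTopologicalAddGroup E] [ContinuousSMul ℝ E]
    [LocallyConvexSpace ℝ E] {B : Set E}
    (hB : ∀ φ : WeakDual ℝ E, ∃ C : ℝ, ∀ x ∈ B, |φ x| ≤ C) : Bornology.IsVonNBounded ℝ B := by
  intro U hU
  obtain ⟨V, hV, hVU⟩ := exists_mem_nhds_polarInSpace_polarInDual_subset hU
  obtain ⟨C, hC⟩ := exists_uniform_bound_of_isCompact_convex (isCompact_polarInDual hV)
    (absConvex_polarInDual V).2 hB
  suffices h : Absorbs ℝ (polarInSpace (polarInDual V)) B from h.mono_left hVU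
  refine absorbs_iff_norm.2 ⟨max C 1, fun c hc x hx => ?_⟩
  have hc0 : 0 < |c| := by
    have : (1 : ℝ) ≤ |c| := (le_max_right _ _).trans hc
    linarith
  have hc0' : c ≠ 0 := abs_pos.1 hc0
  rw [mem_smul_set_iff_inv_smul_mem₀ hc0']
  intro φ hφ
  rw [map_smul, smul_eq_mul, abs_mul, abs_inv, inv_mul_le_iff₀ hc0, mul_one]
  exact (hC φ hφ x hx).trans ((le_max_left _ _).trans hc)

theorem Bornology.IsVonNBounded.exists_bound_dual {B : Set E} (hB : Bornology.IsVonNBounded ℝ B)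
    (φ : WeakDual ℝ E) : ∃ C : ℝ, ∀ x ∈ B, |φ x| ≤ C := by
  have h : Bornology.IsVonNBounded ℝ ((φ : E →L[ℝ] ℝ) '' B) := hB.image (φ : E →L[ℝ] ℝ)
  rw [NormedSpace.isVonNBounded_iff, isBounded_iff_forall_norm_le] at h
  obtain ⟨C, hC⟩ := h
  exact ⟨C, fun x hx => hC _ (mem_image_of_mem _ hx)⟩

end Polars

/-! ### Elementary consequences of the bornology axioms -/

section BornologicalClasses

variable {𝔅 : FunctionClass.{u}}

theorem IsConvexVectorBornology.singleton_mem {V : Type u} [AddCommGroup V] [Module ℝ V]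
    {𝓑 : Set (Set V)} (h : IsConvexVectorBornology 𝓑) (v : V) : {v} ∈ 𝓑 := by
  have hv : v ∈ ⋃₀ 𝓑 := by rw [h.covers]; trivial
  obtain ⟨A, hA, hvA⟩ := hv
  exact h.subset_mem A hA _ (singleton_subset_iff.2 hvA)

theorem IsConvexVectorBornology.smul_singleton_mem {V : Type u} [AddCommGroup V] [Module ℝ V]
    {𝓑 : Set (Set V)} (h : IsConvexVectorBornology 𝓑) (v : V) (C : ℝ) :
    {w | ∃ c : ℝ, |c| ≤ C ∧ w = c • v} ∈ 𝓑 := by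
  refine h.subset_mem _ (h.balancedHull_mem _ (h.singleton_mem (C • v))) _ ?_
  rintro _ ⟨c, hc, rfl⟩
  rw [mem_balancedHull_iff]
  obtain rfl | hC := eq_or_ne C 0
  · obtain rfl : c = 0 := abs_nonpos_iff.1 hc
    exact ⟨0, by simp, by simp⟩
  · refine ⟨c / C, ?_, C • v, rfl, ?_⟩
    · have hC0 : 0 < C := lt_of_le_of_ne ((abs_nonneg c).trans hc) hC.symm
      rw [Real.norm_eq_abs, abs_div, abs_of_pos hC0]
      exact (div_le_one hC0).2 hc
    · simp only [smul_smul]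
      rw [div_mul_cancel₀ _ hC]

end BornologicalClasses

/-! ### The bornology of co-small sets -/

section CoSmall

variable {E : Type u} [AddCommGroup E] [Module ℝ E] [τ : TopologicalSpace E]
variable {𝔅 : FunctionClass.{u}}
variable {K L : Type u} [TopologicalSpace K] [TopologicalSpace L]

/-- The function `l ↦ α(l)(x)` of a vector `x` and a family `α` of functionals. -/
noncomputable def evalAlong (α : C(L, WeakDual ℝ E)) (x : E) : C(L, ℝ) where
  toFun l := α l x
  continuous_toFun := (WeakDual.eval_continuous x).comp α.continuous

theorem pullbackFamily_evalAlong (α : C(L, WeakDual ℝ E)) (β : C(K, L)) (A : Set E) :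
    pullbackFamily β (evalAlong α '' A) = evalAlong (α.comp β) '' A := by
  rw [pullbackFamily, image_image]
  rfl

/-- The inclusion of a set of functionals into the weak-star dual. -/
def inclusionMap (M : Set (WeakDual ℝ E)) : C(M, WeakDual ℝ E) := ⟨_, continuous_subtype_val⟩

theorem evalAlong_inclusionMap (M : Set (WeakDual ℝ E)) (A : Set E) :
    evalAlong (inclusionMap M) '' A = restrictionMap M '' A := rfl

/-- The empty set is a legitimate bounded test set, which releases the part of the definition that
does not depend on it. -/
theorem isEquicontinuousSet_of_mem_coSmall {M : Set (WeakDual ℝ E)} (hM : M ∈ coSmall 𝔅 τ) :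
    IsEquicontinuousSet M :=
  (hM ∅ (Bornology.isVonNBounded_empty _ _)).1

theorem isCompact_closure_of_mem_coSmall {M : Set (WeakDual ℝ E)} (hM : M ∈ coSmall 𝔅 τ) :
    IsCompact (closure M) :=
  isCompact_iff_compactSpace.2 (hM ∅ (Bornology.isVonNBounded_empty _ _)).2.1

theorem polarInSpace_closure (M : Set (WeakDual ℝ E)) :
    polarInSpace (closure M) = polarInSpace M := by
  refine (polarInSpace_anti subset_closure).antisymm fun x hx φ hφ => ?_
  exact closure_minimal (t := {φ : WeakDual ℝ E | |φ x| ≤ 1}) (fun φ hφ => hx φ hφ)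
    (isClosed_le (WeakDual.eval_continuous x).abs continuous_const) hφ

variable [CompactSpace K] [T2Space K] [CompactSpace L] [T2Space L]

theorem evalAlong_image_mem (h𝔅 : IsBornologicalClass 𝔅) {M : Set (WeakDual ℝ E)}
    (hM : M ∈ coSmall 𝔅 τ) (α : C(L, WeakDual ℝ E)) (hα : ∀ l, α l ∈ closure M) {A : Set E}
    (hA : Bornology.IsVonNBounded ℝ A) : evalAlong α '' A ∈ 𝔅 L := by
  obtain ⟨-, hc, h⟩ := hM A hA
  have h1 := h𝔅.comp_mem L (closure M) ⟨fun l => ⟨α l, hα l⟩, by fun_prop⟩ _ h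
  rw [pullbackFamily, image_image] at h1
  exact h1

/-- The class descends along the surjection of `L` onto the compact range of `α`, and then pulls
back along the inclusion of `N`. -/
theorem restrictionMap_range_mem (h𝔅 : IsBornologicalClass 𝔅) (α : C(L, WeakDual ℝ E))
    {A : Set E} (h : evalAlong α '' A ∈ 𝔅 L) (N : Set (WeakDual ℝ E)) [CompactSpace N]
    (hN : N ⊆ range α) : restrictionMap N '' A ∈ 𝔅 N := by
  have : CompactSpace (range α) := isCompact_iff_compactSpace.1 (isCompact_range α.continuous)
  have h1 : restrictionMap (range α) '' A ∈ 𝔅 (range α) :=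
    h𝔅.mem_of_comp_mem L (range α) ⟨rangeFactorization α, by fun_prop⟩ _
      rangeFactorization_surjective (by rw [← evalAlong_inclusionMap, pullbackFamily_evalAlong]; exact h)
  have h2 := h𝔅.comp_mem N (range α) ⟨inclusion hN, continuous_inclusion hN⟩ _ h1
  rw [pullbackFamily, image_image] at h2
  exact h2

/-- The range is compact, hence closed, and so contains `closure M` as well. This is the device by
which all stability properties are proved. -/
theorem mem_coSmall_of_subset_range (h𝔅 : IsBornologicalClass 𝔅) (α : C(L, WeakDual ℝ E))
    {M : Set (WeakDual ℝ E)} (hM : M ⊆ range α) (hE : IsEquicontinuousSet M)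
    (h : ∀ A : Set E, Bornology.IsVonNBounded ℝ A → evalAlong α '' A ∈ 𝔅 L) :
    M ∈ coSmall 𝔅 τ := by
  intro A hA
  have hr : IsCompact (range α) := isCompact_range α.continuous
  have hcl : closure M ⊆ range α := closure_minimal hM hr.isClosed
  have hc : CompactSpace (closure M) := isCompact_iff_compactSpace.1
    (hr.of_isClosed_subset isClosed_closure hcl)
  exact ⟨hE, hc, restrictionMap_range_mem h𝔅 α (h A hA) _ hcl⟩

/-- Allowing `N` inside the closure handles subsets and weak-star closures at once. -/
theorem subset_mem_coSmall (h𝔅 : IsBornologicalClass 𝔅) {M N : Set (WeakDual ℝ E)}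
    (hM : M ∈ coSmall 𝔅 τ) (hN : IsEquicontinuousSet N) (hNM : N ⊆ closure M) :
    N ∈ coSmall 𝔅 τ := by
  have : CompactSpace (closure M) :=
    isCompact_iff_compactSpace.1 (isCompact_closure_of_mem_coSmall hM)
  refine mem_coSmall_of_subset_range h𝔅 (inclusionMap (closure M)) ?_ hN fun A hA =>
    evalAlong_image_mem h𝔅 hM _ (fun l => l.2) hA
  rintro φ hφ
  exact ⟨⟨φ, hNM hφ⟩, rfl⟩

variable [IsTopologicalAddGroup E] [ContinuousSMul ℝ E]

theorem IsEquicontinuousSet.mono {M N : Set (WeakDual ℝ E)} (hM : IsEquicontinuousSet M)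
    (hNM : N ⊆ M) : IsEquicontinuousSet N :=
  isEquicontinuousSet_of_polarInSpace_mem_nhds
    (Filter.mem_of_superset hM.polarInSpace_mem_nhds (polarInSpace_anti hNM))

theorem IsEquicontinuousSet.closure {M : Set (WeakDual ℝ E)} (hM : IsEquicontinuousSet M) :
    IsEquicontinuousSet (closure M) :=
  isEquicontinuousSet_of_polarInSpace_mem_nhds
    (by rw [polarInSpace_closure]; exact hM.polarInSpace_mem_nhds)

theorem isEquicontinuousSet_singleton (φ : WeakDual ℝ E) : IsEquicontinuousSet {φ} := by
  refine isEquicontinuousSet_of_polarInSpace_mem_nhds ?_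
  have : polarInSpace {φ} = {x : E | |φ x| ≤ 1} := by ext; simp [polarInSpace]
  rw [this]
  have hc : Continuous fun x : E => |φ x| := (ContinuousLinearMap.continuous φ).abs
  have h0 : |φ 0| < 1 := by rw [map_zero, abs_zero]; exact one_pos
  filter_upwards [(hc.tendsto 0).eventually (gt_mem_nhds h0)] with x hx
  exact hx.le

/-- On a one-point space the evaluations are uniformly bounded constants, which lie in the balanced
hull of a singleton. -/
theorem singleton_mem_coSmall (h𝔅 : IsBornologicalClass 𝔅) (φ : WeakDual ℝ E) :
    {φ} ∈ coSmall 𝔅 τ := by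
  refine mem_coSmall_of_subset_range (L := PUnit.{u + 1}) h𝔅 (ContinuousMap.const _ φ) (by simp)
    (isEquicontinuousSet_singleton φ) fun A hA => ?_
  obtain ⟨C, hC⟩ := hA.exists_bound_dual φ
  have h := h𝔅.convexVectorBornology PUnit.{u + 1}
  refine h.subset_mem _ (h.smul_singleton_mem (ContinuousMap.const _ 1) C) _ ?_
  rintro _ ⟨x, hx, rfl⟩
  exact ⟨φ x, hC x hx, by ext; simp [evalAlong]⟩

theorem smul_mem_coSmall (h𝔅 : IsBornologicalClass 𝔅) {M : Set (WeakDual ℝ E)}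
    (hM : M ∈ coSmall 𝔅 τ) (c : ℝ) : c • M ∈ coSmall 𝔅 τ := by
  have : CompactSpace (closure M) :=
    isCompact_iff_compactSpace.1 (isCompact_closure_of_mem_coSmall hM)
  refine mem_coSmall_of_subset_range h𝔅
    (⟨fun l => c • (l : WeakDual ℝ E), by fun_prop⟩ : C(closure M, WeakDual ℝ E)) ?_ ?_ ?_
  · rintro _ ⟨φ, hφ, rfl⟩
    exact ⟨⟨φ, subset_closure hφ⟩, rfl⟩
  · refine isEquicontinuousSet_of_polarInSpace_mem_nhds ?_
    have ht : Filter.Tendsto (fun x : E => c • x) (𝓝 0) (𝓝 0) := by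
      have : Continuous fun x : E => c • x := by fun_prop
      simpa using this.tendsto 0
    filter_upwards [ht (isEquicontinuousSet_of_mem_coSmall hM).polarInSpace_mem_nhds] with x hx
    exact mem_polarInSpace_smul.2 hx
  · intro A hA
    refine (h𝔅.convexVectorBornology _).subset_mem _ ((h𝔅.convexVectorBornology _).smul_mem c _
      (evalAlong_image_mem h𝔅 hM (inclusionMap (closure M)) (fun l => l.2) hA)) _ ?_
    rintro _ ⟨x, hx, rfl⟩
    exact ⟨_, mem_image_of_mem _ hx, rfl⟩

/-- On the product of the closures, evaluation at `x` is the sum of two pulled-back evaluations, so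
axiom closure under sums applies. -/
theorem add_mem_coSmall (h𝔅 : IsBornologicalClass 𝔅) {M N : Set (WeakDual ℝ E)}
    (hM : M ∈ coSmall 𝔅 τ) (hN : N ∈ coSmall 𝔅 τ) : M + N ∈ coSmall 𝔅 τ := by
  have : CompactSpace (closure M) :=
    isCompact_iff_compactSpace.1 (isCompact_closure_of_mem_coSmall hM)
  have : CompactSpace (closure N) :=
    isCompact_iff_compactSpace.1 (isCompact_closure_of_mem_coSmall hN)
  refine mem_coSmall_of_subset_range h𝔅
    (⟨fun l => (l.1 : WeakDual ℝ E) + l.2, by fun_prop⟩ :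
      C(closure M × closure N, WeakDual ℝ E)) ?_ ?_ ?_
  · rintro _ ⟨φ, hφ, ψ, hψ, rfl⟩
    exact ⟨⟨⟨φ, subset_closure hφ⟩, ⟨ψ, subset_closure hψ⟩⟩, rfl⟩
  · refine isEquicontinuousSet_of_polarInSpace_mem_nhds ?_
    have ht : Filter.Tendsto (fun x : E => (2 : ℝ) • x) (𝓝 0) (𝓝 0) := by
      have : Continuous fun x : E => (2 : ℝ) • x := by fun_prop
      simpa using this.tendsto 0
    filter_upwards [ht (isEquicontinuousSet_of_mem_coSmall hM).polarInSpace_mem_nhds,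
      ht (isEquicontinuousSet_of_mem_coSmall hN).polarInSpace_mem_nhds]
    rintro x hx hx' _ ⟨φ, hφ, ψ, hψ, rfl⟩
    have h1 := abs_le.1 (hx φ hφ)
    have h2 := abs_le.1 (hx' ψ hψ)
    rw [map_smul, smul_eq_mul] at h1 h2
    change |φ x + ψ x| ≤ 1
    exact abs_le.2 ⟨by linarith, by linarith⟩
  · intro A hA
    have h := h𝔅.convexVectorBornology (closure M × closure N)
    refine h.subset_mem _ (h.add_mem _
      (evalAlong_image_mem h𝔅 hM ((inclusionMap (closure M)).comp ContinuousMap.fst)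
        (fun l => l.1.2) hA) _
      (evalAlong_image_mem h𝔅 hN ((inclusionMap (closure N)).comp ContinuousMap.snd)
        (fun l => l.2.2) hA)) _ ?_
    rintro _ ⟨x, hx, rfl⟩
    exact ⟨_, mem_image_of_mem _ hx, _, mem_image_of_mem _ hx, rfl⟩

/-- The restriction operator `E → C(K)` for an equicontinuous compact set `K` of functionals. -/
noncomputable def restrictionCLM (M : Set (WeakDual ℝ E)) [CompactSpace M]
    (hM : IsEquicontinuousSet M) : E →L[ℝ] C(M, ℝ) :=
  let f : E →ₗ[ℝ] C(M, ℝ) :=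
    { toFun := restrictionMap M
      map_add' := fun x y => by ext φ; exact map_add (φ : WeakDual ℝ E) x y
      map_smul' := fun c x => by ext φ; exact map_smul (φ : WeakDual ℝ E) c x }
  ⟨f, by
    refine continuous_of_continuousAt_zero f ?_
    rw [ContinuousAt, map_zero, Metric.tendsto_nhds]
    intro ε hε
    have ht : Filter.Tendsto (fun y : E => (2 / ε) • y) (𝓝 0) (𝓝 0) := by
      have : Continuous fun y : E => (2 / ε) • y := by fun_prop
      simpa using this.tendsto 0
    filter_upwards [ht hM.polarInSpace_mem_nhds] with y hy
    rw [dist_zero_right, ContinuousMap.norm_lt_iff _ hε]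
    intro φ
    have h1 := hy φ φ.2
    rw [map_smul, smul_eq_mul, abs_mul, abs_of_pos (by positivity), div_mul_eq_mul_div,
      div_le_one hε] at h1
    change |(φ : WeakDual ℝ E) y| < ε
    linarith [abs_nonneg ((φ : WeakDual ℝ E) y)]⟩

/-- A functional that is bounded by one on the polar of `M` extends to a functional of norm at most
one on `C(M)`. -/
theorem exists_dualUnitBall_comp_restrictionCLM (M : Set (WeakDual ℝ E)) [CompactSpace M]
    (hM : IsEquicontinuousSet M) {ψ : WeakDual ℝ E} (hψ : ψ ∈ polarInDual (polarInSpace M)) :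
    ∃ φ ∈ dualUnitBall M, ∀ x, φ (restrictionCLM M hM x) = ψ x := by
  set r := restrictionCLM M hM with hr
  -- The polar of `M` is the preimage of the unit ball under `r`. Thus `ψ` vanishes on the kernel of
  -- `r` and factors through its range with norm at most one.
  have hle : ∀ x, |ψ x| ≤ ‖r x‖ := by
    intro x
    refine le_of_forall_gt_imp_ge_of_dense fun c hc => ?_
    have hc0 : 0 < c := (norm_nonneg _).trans_lt hc
    have hx : c⁻¹ • x ∈ polarInSpace M := by
      intro φ hφ
      have h1 : |φ x| ≤ ‖r x‖ := (r x).norm_coe_le_norm ⟨φ, hφ⟩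
      rw [map_smul, smul_eq_mul, abs_mul, abs_of_pos (inv_pos.2 hc0), inv_mul_le_iff₀ hc0, mul_one]
      exact h1.trans hc.le
    have h2 := hψ _ hx
    rwa [map_smul, smul_eq_mul, abs_mul, abs_of_pos (inv_pos.2 hc0), inv_mul_le_iff₀ hc0,
      mul_one] at h2
  let rl : E →ₗ[ℝ] C(M, ℝ) := r
  let ψl : E →ₗ[ℝ] ℝ := (ψ : E →L[ℝ] ℝ)
  have hker : LinearMap.ker rl ≤ LinearMap.ker ψl := by
    intro x hx
    have hx' : r x = 0 := hx
    have := hle x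
    rw [hx', norm_zero] at this
    exact abs_nonpos_iff.1 this
  let g : LinearMap.range rl →ₗ[ℝ] ℝ :=
    ((LinearMap.ker rl).liftQ ψl hker).comp rl.quotKerEquivRange.symm.toLinearMap
  have hg : ∀ x, g ⟨rl x, x, rfl⟩ = ψ x := by
    intro x
    have : rl.quotKerEquivRange.symm ⟨rl x, x, rfl⟩ = (LinearMap.ker rl).mkQ x := by
      rw [LinearEquiv.symm_apply_eq]
      rfl
    simp only [g, LinearMap.comp_apply, LinearEquiv.coe_coe, this]
    rfl
  let gc : StrongDual ℝ (LinearMap.range rl) := g.mkContinuous 1 (by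
    rintro ⟨_, x, rfl⟩
    rw [hg, one_mul]
    exact hle x)
  obtain ⟨φ, hφ, hφn⟩ := exists_extension_norm_eq (LinearMap.range rl) gc
  have hn : ‖φ‖ ≤ 1 := hφn ▸ LinearMap.mkContinuous_norm_le _ zero_le_one _
  refine ⟨φ, fun f => ?_, fun x => ?_⟩
  · have := φ.le_of_opNorm_le hn f
    rwa [one_mul] at this
  · exact (hφ ⟨rl x, x, rfl⟩).trans (hg x)

/-- The adjoint of the restriction operator parametrizes a set containing the bipolar by the dual
unit ball of `C(closure M)`. Evaluations along it are exactly the functions controlled by polar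
compatibility. -/
theorem bipolar_mem_coSmall (h𝔅 : IsBornologicalClass 𝔅) (hp : IsPolarlyCompatible 𝔅)
    {M : Set (WeakDual ℝ E)} (hM : M ∈ coSmall 𝔅 τ) :
    polarInDual (polarInSpace M) ∈ coSmall 𝔅 τ := by
  have hK : CompactSpace (closure M) :=
    isCompact_iff_compactSpace.1 (isCompact_closure_of_mem_coSmall hM)
  have hE := (isEquicontinuousSet_of_mem_coSmall hM).closure
  let r := restrictionCLM (closure M) hE
  let α : C(dualUnitBall (closure M), WeakDual ℝ E) :=
    ⟨fun φ => ((φ : WeakDual ℝ C(closure M, ℝ)) : C(closure M, ℝ) →L[ℝ] ℝ).comp r, by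
      refine WeakDual.continuous_of_continuous_eval fun x => ?_
      exact (WeakDual.eval_continuous (r x)).comp continuous_subtype_val⟩
  refine mem_coSmall_of_subset_range h𝔅 α ?_ (isEquicontinuousSet_polarInDual
    (isEquicontinuousSet_of_mem_coSmall hM).polarInSpace_mem_nhds) fun A hA => ?_
  · intro ψ hψ
    rw [← polarInSpace_closure] at hψ
    obtain ⟨φ, hφ, h⟩ := exists_dualUnitBall_comp_restrictionCLM (closure M) hE hψ
    exact ⟨⟨φ, hφ⟩, ContinuousLinearMap.ext h⟩
  · obtain ⟨-, hc, h⟩ := hM A hA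
    have h1 := hp (closure M) _ h
    rw [image_image] at h1
    exact h1

theorem isConvexVectorBornology_coSmall (h𝔅 : IsBornologicalClass 𝔅)
    (hp : IsPolarlyCompatible 𝔅) : IsConvexVectorBornology (coSmall 𝔅 τ) := by
  have hsub : ∀ M ∈ coSmall 𝔅 τ, ∀ N ⊆ M, N ∈ coSmall 𝔅 τ := fun M hM N hN =>
    subset_mem_coSmall h𝔅 hM ((isEquicontinuousSet_of_mem_coSmall hM).mono hN)
      (hN.trans subset_closure)
  refine ⟨?_, hsub, ?_, fun M hM N hN => add_mem_coSmall h𝔅 hM hN,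
    fun c M hM => smul_mem_coSmall h𝔅 hM c, ?_, ?_⟩
  · exact eq_univ_of_forall fun φ => ⟨{φ}, singleton_mem_coSmall h𝔅 φ, rfl⟩
  -- Both bipolars contain zero, so `M ∪ N ⊆ M°° + N°°`.
  · intro M hM N hN
    refine hsub _ (add_mem_coSmall h𝔅 (bipolar_mem_coSmall h𝔅 hp hM)
      (bipolar_mem_coSmall h𝔅 hp hN)) _ (union_subset ?_ ?_)
    · exact fun φ hφ => ⟨φ, subset_polarInDual_polarInSpace M hφ, 0,
        fun x _ => by change |(0 : ℝ)| ≤ 1; simp, add_zero φ⟩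
    · exact fun φ hφ => ⟨0, fun x _ => by change |(0 : ℝ)| ≤ 1; simp, φ,
        subset_polarInDual_polarInSpace N hφ, zero_add φ⟩
  · exact fun M hM => hsub _ (bipolar_mem_coSmall h𝔅 hp hM) _
      ((absConvex_polarInDual _).1.balancedHull_subset_of_subset
        (subset_polarInDual_polarInSpace M))
  · exact fun M hM => hsub _ (bipolar_mem_coSmall h𝔅 hp hM) _
      (convexHull_min (subset_polarInDual_polarInSpace M) (absConvex_polarInDual _).2)

theorem isSaturatedBornology_coSmall (h𝔅 : IsBornologicalClass 𝔅) :
    IsSaturatedBornology (coSmall 𝔅 τ) := fun _ hM =>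
  subset_mem_coSmall h𝔅 hM (isEquicontinuousSet_of_mem_coSmall hM).closure Subset.rfl

end CoSmall

/-! ### Polar topologies and comparison with the weak and Mackey topologies -/

section PolarTopology

open Filter

variable {E : Type u} [AddCommGroup E] [Module ℝ E]

theorem le_of_nhds_zero_le {G : Type u} [AddCommGroup G] {s t : TopologicalSpace G}
    (hs : @IsTopologicalAddGroup G s _) (ht : @IsTopologicalAddGroup G t _)
    (h : @nhds G s 0 ≤ @nhds G t 0) : s ≤ t := by
  refine le_of_nhds_le_nhds fun x => ?_
  rw [← @map_add_left_nhds_zero G s _ _ x, ← @map_add_left_nhds_zero G t _ _ x]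
  exact map_mono h

theorem continuous_of_forall_abs_le_mem_nhds [TopologicalSpace E] [IsTopologicalAddGroup E]
    (f : E →ₗ[ℝ] ℝ) (h : ∀ ε : ℝ, 0 < ε → {x : E | |f x| ≤ ε} ∈ 𝓝 (0 : E)) : Continuous f := by
  refine continuous_of_continuousAt_zero f ?_
  rw [ContinuousAt, map_zero, Metric.tendsto_nhds]
  intro ε hε
  filter_upwards [h (ε / 2) (by linarith)] with x hx
  rw [dist_zero_right, Real.norm_eq_abs]
  exact lt_of_le_of_lt hx (by linarith)

variable [τ : TopologicalSpace E] {𝓑 : Set (Set (WeakDual ℝ E))}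

theorem isTopologicalAddGroup_polarTopology (𝓑 : Set (Set (WeakDual ℝ E))) :
    @IsTopologicalAddGroup E (polarTopology τ 𝓑) _ := by
  let f : E →+ UniformOnFun (WeakDual ℝ E) ℝ 𝓑 :=
    { toFun := fun x => UniformOnFun.ofFun 𝓑 fun φ : WeakDual ℝ E => φ x
      map_zero' := by funext φ; exact map_zero φ
      map_add' := fun x y => by funext φ; exact map_add φ x y }
  exact topologicalAddGroup_induced f

theorem polarInSpace_mem_nhds_polarTopology {M : Set (WeakDual ℝ E)} (hM : M ∈ 𝓑) :
    polarInSpace M ∈ @nhds E (polarTopology τ 𝓑) 0 := by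
  rw [nhds_induced]
  have h := UniformOnFun.gen_mem_nhds ℝ 𝓑
    (UniformOnFun.ofFun 𝓑 fun φ : WeakDual ℝ E => φ (0 : E)) hM
    (Metric.dist_mem_uniformity (α := ℝ) one_pos)
  refine mem_of_superset (preimage_mem_comap h) fun x hx φ hφ => ?_
  have h1 : dist (φ 0) (φ x) < 1 := hx φ hφ
  rw [map_zero, dist_zero_left] at h1
  exact h1.le

theorem hasBasis_nhds_polarTopology [IsTopologicalAddGroup E] [ContinuousSMul ℝ E]
    (h𝓑 : IsConvexVectorBornology 𝓑) :
    (@nhds E (polarTopology τ 𝓑) 0).HasBasis (fun M => M ∈ 𝓑) polarInSpace := by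
  refine ⟨fun U => ⟨fun hU => ?_, fun ⟨M, hM, hMU⟩ =>
    mem_of_superset (polarInSpace_mem_nhds_polarTopology hM) hMU⟩⟩
  have hdir : DirectedOn (· ⊆ ·) 𝓑 := fun M hM N hN =>
    ⟨M ∪ N, h𝓑.union_mem M hM N hN, subset_union_left, subset_union_right⟩
  have hne : 𝓑.Nonempty := ⟨_, h𝓑.singleton_mem 0⟩
  have hb := UniformOnFun.hasBasis_nhds_of_basis (WeakDual ℝ E) ℝ 𝓑
    (UniformOnFun.ofFun 𝓑 fun φ : WeakDual ℝ E => φ (0 : E)) hne hdir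
    Metric.uniformity_basis_dist
  rw [nhds_induced] at hU
  obtain ⟨⟨M, ε⟩, ⟨hM, hε⟩, hU⟩ := (hb.comap _).mem_iff.1 hU
  simp only at hM hε hU
  -- Scalar multiples belong to the bornology, so the tolerance `ε` is absorbed into the set.
  refine ⟨(2 / ε) • M, h𝓑.smul_mem _ M hM, fun x hx => hU fun φ hφ => ?_⟩
  change dist (φ x) (φ 0) < ε
  have h1 := mem_polarInSpace_smul.1 hx φ hφ
  rw [map_smul, smul_eq_mul, abs_mul, abs_of_pos (by positivity), div_mul_eq_mul_div,
    div_le_one hε] at h1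
  rw [map_zero, dist_zero_right, Real.norm_eq_abs]
  linarith [abs_nonneg (φ x)]

theorem convex_polarInSpace (M : Set (WeakDual ℝ E)) : Convex ℝ (polarInSpace M) := by
  intro x hx y hy s t hs ht hst φ hφ
  have h1 := abs_le.1 (hx φ hφ)
  have h2 := abs_le.1 (hy φ hφ)
  rw [map_add, map_smul, map_smul, smul_eq_mul, smul_eq_mul, abs_le]
  constructor <;> nlinarith

theorem isLocallyConvexTopology_polarTopology [IsTopologicalAddGroup E] [ContinuousSMul ℝ E]
    (h𝓑 : IsConvexVectorBornology 𝓑) (hE : ∀ M ∈ 𝓑, IsEquicontinuousSet M) :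
    IsLocallyConvexTopology (polarTopology τ 𝓑) := by
  have hgrp := isTopologicalAddGroup_polarTopology (τ := τ) 𝓑
  refine ⟨hgrp, ?_, @LocallyConvexSpace.ofBasisZero ℝ E _ _ _ _ (polarTopology τ 𝓑) hgrp _ _ _
    (hasBasis_nhds_polarTopology h𝓑) fun M _ => convex_polarInSpace M⟩
  let Φ : E →ₗ[ℝ] (WeakDual ℝ E → ℝ) :=
    { toFun := fun x φ => φ x
      map_add' := fun x y => by funext φ; exact map_add φ x y
      map_smul' := fun c x => by ext φ; exact map_smul φ c x }
  -- Continuity of scalar multiplication needs each vector to be bounded on each `M`, which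
  -- equicontinuity supplies.
  refine @UniformOnFun.continuousSMul_induced_of_image_bounded ℝ (WeakDual ℝ E) ℝ E
    (E →ₗ[ℝ] (WeakDual ℝ E → ℝ)) _ _ _ _ _ (polarTopology τ 𝓑) _ _ _
    𝓑 _ _ Φ ?_ ?_
  · exact @IsInducing.mk _ _ (polarTopology τ 𝓑) _ _ rfl
  · intro x M hM
    obtain ⟨r, hr, hrx⟩ := exists_bound_of_mem_nhds_zero (hE M hM).polarInSpace_mem_nhds x
    rw [NormedSpace.isVonNBounded_iff, isBounded_iff_forall_norm_le]
    refine ⟨r⁻¹, ?_⟩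
    rintro _ ⟨φ, hφ, rfl⟩
    have h1 := hrx φ hφ
    rw [map_smul, smul_eq_mul, abs_mul, abs_of_pos hr] at h1
    change |φ x| ≤ r⁻¹
    rw [inv_eq_one_div, le_div_iff₀ hr]
    linarith

theorem continuous_dual_polarTopology [ContinuousConstSMul ℝ E]
    [ContinuousAdd E] (h𝓑 : IsConvexVectorBornology 𝓑) (φ : WeakDual ℝ E) :
    @Continuous E ℝ (polarTopology τ 𝓑) _ φ := by
  let f : E →ₗ[ℝ] ℝ := (φ : E →L[ℝ] ℝ)
  refine @continuous_of_forall_abs_le_mem_nhds E _ _ (polarTopology τ 𝓑)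
    (isTopologicalAddGroup_polarTopology 𝓑) f fun ε hε => ?_
  refine mem_of_superset (polarInSpace_mem_nhds_polarTopology
    (h𝓑.smul_mem ε⁻¹ _ (h𝓑.singleton_mem φ))) fun x hx => ?_
  have := mem_polarInSpace_smul.1 hx φ rfl
  rw [map_smul, smul_eq_mul, abs_mul, abs_of_pos (inv_pos.2 hε), inv_mul_le_iff₀ hε,
    mul_one] at this
  exact this

theorem polarTopology_le_weakTopology [IsTopologicalAddGroup E] [ContinuousSMul ℝ E]
    (h𝓑 : IsConvexVectorBornology 𝓑) : polarTopology τ 𝓑 ≤ weakTopology τ := by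
  rw [weakTopology, ← continuous_iff_le_induced]
  exact continuous_induced_rng.2 (@continuous_pi _ _ _ (polarTopology τ 𝓑) _ _
    fun φ => continuous_dual_polarTopology h𝓑 φ)

theorem le_polarTopology [IsTopologicalAddGroup E] [ContinuousSMul ℝ E]
    (h𝓑 : IsConvexVectorBornology 𝓑) (hE : ∀ M ∈ 𝓑, IsEquicontinuousSet M) :
    τ ≤ polarTopology τ 𝓑 := by
  refine le_of_nhds_zero_le inferInstance (isTopologicalAddGroup_polarTopology 𝓑) ?_
  rw [(hasBasis_nhds_polarTopology h𝓑).ge_iff]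
  exact fun M hM => (hE M hM).polarInSpace_mem_nhds

/-- Polars of neighbourhoods are absolutely convex and weak-star compact, and their polars recover
the topology. Only that polars of members are neighbourhoods is used, so the family need not be a
bornology. -/
theorem mackeyTopology_le [IsTopologicalAddGroup E] [ContinuousSMul ℝ E]
    [LocallyConvexSpace ℝ E] : mackeyTopology τ ≤ τ := by
  refine le_of_nhds_zero_le (isTopologicalAddGroup_polarTopology _) inferInstance fun U hU => ?_
  obtain ⟨V, hV, hVU⟩ := exists_mem_nhds_polarInSpace_polarInDual_subset hU
  exact mem_of_superset (polarInSpace_mem_nhds_polarTopology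
    (𝓑 := {M | IsCompact M ∧ AbsConvex ℝ M})
    ⟨isCompact_polarInDual hV, absConvex_polarInDual V⟩) hVU

theorem t2Space_weakTopology [IsTopologicalAddGroup E] [ContinuousSMul ℝ E]
    [LocallyConvexSpace ℝ E] [T2Space E] : @T2Space E (weakTopology τ) := by
  refine @T2Space.of_injective_continuous E (WeakSpace ℝ E) (weakTopology τ) _ ?_ _
    (toWeakSpace ℝ E).injective continuous_induced_dom
  refine ⟨fun x y hxy => ?_⟩
  obtain ⟨f, hf⟩ := SeparatingDual.exists_separating_of_ne (R := ℝ)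
    (show (toWeakSpace ℝ E).symm x ≠ (toWeakSpace ℝ E).symm y from
      fun h => hxy ((toWeakSpace ℝ E).symm.injective h))
  exact separated_by_continuous (WeakBilin.eval_continuous (topDualPairing ℝ E).flip f) hf

end PolarTopology

/-! ### Transfer between two spaces along a continuous linear map -/

section StrongestSmall

variable {E F : Type u} [AddCommGroup E] [Module ℝ E] [τ : TopologicalSpace E]
  [AddCommGroup F] [Module ℝ F] [σ : TopologicalSpace F] {𝔅 : FunctionClass.{u}}

/-- The adjoint of a continuous linear map, restricted to a set of functionals. -/
def adjointOn (j : E →L[ℝ] F) (N : Set (WeakDual ℝ F)) : C(N, WeakDual ℝ E) where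
  toFun φ := ((φ : WeakDual ℝ F) : F →L[ℝ] ℝ).comp j
  continuous_toFun := WeakDual.continuous_of_continuous_eval fun x =>
    (WeakDual.eval_continuous (j x)).comp continuous_subtype_val

theorem evalAlong_adjointOn (j : E →L[ℝ] F) (N : Set (WeakDual ℝ F)) (A : Set E) :
    evalAlong (adjointOn j N) '' A = restrictionMap N '' (j '' A) := by
  rw [image_image]
  rfl

variable [IsTopologicalAddGroup E] [ContinuousSMul ℝ E]

/-- Smallness of `σ`, tested on `j(A)` and the compact set `V°`, says that the adjoint image of `V°`
is co-small. Taking `j` to be the identity between two topologies compares them. -/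
theorem exists_mem_coSmall_image_polarInSpace_subset [IsTopologicalAddGroup F]
    [ContinuousSMul ℝ F] [LocallyConvexSpace ℝ F] (h𝔅 : IsBornologicalClass 𝔅)
    (hσ : IsSmallTopology 𝔅 σ) (j : E →L[ℝ] F) {U : Set F} (hU : U ∈ 𝓝 (0 : F)) :
    ∃ M ∈ coSmall 𝔅 τ, ∀ x ∈ polarInSpace M, j x ∈ U := by
  obtain ⟨V, hV, hVU⟩ := exists_mem_nhds_polarInSpace_polarInDual_subset hU
  have hK : CompactSpace (polarInDual V) :=
    isCompact_iff_compactSpace.1 (isCompact_polarInDual hV)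
  refine ⟨range (adjointOn j (polarInDual V)), ?_, fun x hx => hVU fun φ hφ =>
    hx _ ⟨⟨φ, hφ⟩, rfl⟩⟩
  refine mem_coSmall_of_subset_range h𝔅 _ Subset.rfl ?_ fun A hA => ?_
  · refine isEquicontinuousSet_of_polarInSpace_mem_nhds ?_
    have ht : Filter.Tendsto j (𝓝 0) (𝓝 0) := by simpa using j.continuous.tendsto 0
    filter_upwards [ht hV]
    rintro x hx _ ⟨φ, rfl⟩
    exact φ.2 _ hx
  · rw [evalAlong_adjointOn]
    exact (hσ _ (hA.image j)).2 _ (isEquicontinuousSet_polarInDual hV)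

/-- If `j` maps `M°` into `N°`, its adjoint maps `N` into `M°°`, which is again co-small. -/
theorem restrictionMap_image_mem_of_polarInSpace (h𝔅 : IsBornologicalClass 𝔅)
    (hp : IsPolarlyCompatible 𝔅) (j : E →L[ℝ] F)
    (hj : ∀ U ∈ 𝓝 (0 : F), ∃ M ∈ coSmall 𝔅 τ, ∀ x ∈ polarInSpace M, j x ∈ U)
    (N : Set (WeakDual ℝ F)) [CompactSpace N] (hN : IsEquicontinuousSet N) {A : Set E}
    (hA : Bornology.IsVonNBounded ℝ A) {B : Set F} (hB : j '' A = B) :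
    restrictionMap N '' B ∈ 𝔅 N := by
  subst hB
  obtain ⟨M, hM, hMU⟩ := hj _ hN.polarInSpace_mem_nhds
  rw [← evalAlong_adjointOn]
  exact evalAlong_image_mem (L := N) h𝔅 (bipolar_mem_coSmall h𝔅 hp hM) (adjointOn j N)
    (fun φ => subset_closure fun x hx => hMU x hx φ.1 φ.2) hA

end StrongestSmall

/-! ### The strongest small topology -/

section Main

variable {E : Type u} [AddCommGroup E] [Module ℝ E] {𝔅 : FunctionClass.{u}}

theorem isStrongestSmallTopology_coSmallTopology (τ : TopologicalSpace E)
    [IsTopologicalAddGroup E] [ContinuousSMul ℝ E] [LocallyConvexSpace ℝ E]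
    (h𝔅 : IsBornologicalClass 𝔅) (hp : IsPolarlyCompatible 𝔅) :
    IsStrongestSmallTopology 𝔅 τ (coSmallTopology 𝔅 τ) := by
  have hb := isConvexVectorBornology_coSmall (τ := τ) h𝔅 hp
  have hE : ∀ M ∈ coSmall 𝔅 τ, IsEquicontinuousSet M := fun M hM =>
    isEquicontinuousSet_of_mem_coSmall hM
  have hle := le_polarTopology hb hE
  have hlc := isLocallyConvexTopology_polarTopology hb hE
  refine ⟨hlc, ?_, hle, ?_⟩
  · intro B hB
    refine ⟨hB, ?_⟩
    -- All `τ`-continuous functionals are continuous for the polar topology, so `B` is weakly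
    -- bounded and Mackey's theorem applies.
    have hBτ : @Bornology.IsVonNBounded ℝ E _ _ _ τ B := by
      refine isVonNBounded_of_forall_dual fun φ => ?_
      have hφ := continuous_dual_polarTopology hb φ
      exact @Bornology.IsVonNBounded.exists_bound_dual E _ _ (coSmallTopology 𝔅 τ) B hB
        (@ContinuousLinearMap.mk ℝ ℝ _ _ (RingHom.id ℝ) E (coSmallTopology 𝔅 τ) _ ℝ _ _ _ _
          ((φ : E →L[ℝ] ℝ) : E →ₗ[ℝ] ℝ) hφ)
    intro N hNc hN
    exact restrictionMap_image_mem_of_polarInSpace (E := E) (F := E) (τ := τ)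
      (σ := coSmallTopology 𝔅 τ) h𝔅 hp
      (@ContinuousLinearMap.mk ℝ ℝ _ _ (RingHom.id ℝ) E τ _ E (coSmallTopology 𝔅 τ) _ _ _
        LinearMap.id (continuous_id_iff_le.2 hle))
      (fun U hU => (hasBasis_nhds_polarTopology hb).mem_iff.1 hU) N hN hBτ (image_id B)
  · intro σ hσ hsmall hτσ
    have := hσ.1
    have := hσ.2
    have := hσ.3
    refine le_of_nhds_zero_le hlc.1 hσ.1 fun U hU => ?_
    obtain ⟨M, hM, hMU⟩ := exists_mem_coSmall_image_polarInSpace_subset (E := E) (F := E)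
      (τ := τ) (σ := σ) h𝔅 hsmall
      (@ContinuousLinearMap.mk ℝ ℝ _ _ (RingHom.id ℝ) E τ _ E σ _ _ _
        LinearMap.id (continuous_id_iff_le.2 hτσ)) hU
    exact Filter.mem_of_superset (polarInSpace_mem_nhds_polarTopology (τ := τ) hM) hMU

theorem coSmallTopology_properties (τ : TopologicalSpace E)
    [IsTopologicalAddGroup E] [ContinuousSMul ℝ E] [LocallyConvexSpace ℝ E] [T2Space E]
    (h𝔅 : IsBornologicalClass 𝔅) (hp : IsPolarlyCompatible 𝔅) :
    IsConvexVectorBornology (coSmall 𝔅 τ) ∧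
      IsSaturatedBornology (coSmall 𝔅 τ) ∧
      (@nhds E (coSmallTopology 𝔅 τ) 0).HasBasis (fun M => M ∈ coSmall 𝔅 τ) polarInSpace ∧
      @T2Space E (coSmallTopology 𝔅 τ) ∧
      IsStrongestSmallTopology 𝔅 τ (coSmallTopology 𝔅 τ) ∧
      coSmallTopology 𝔅 τ ≤ weakTopology τ ∧ τ ≤ coSmallTopology 𝔅 τ ∧
      mackeyTopology τ ≤ τ := by
  have hb := isConvexVectorBornology_coSmall (τ := τ) h𝔅 hp
  have hs := isStrongestSmallTopology_coSmallTopology τ h𝔅 hp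
  have hw := polarTopology_le_weakTopology hb
  exact ⟨hb, isSaturatedBornology_coSmall h𝔅, hasBasis_nhds_polarTopology hb,
    t2Space_antitone hw t2Space_weakTopology, hs, hw, hs.coarser, mackeyTopology_le⟩

end Main

/-! ### Independent subsequences of `L¹`-separated sequences -/

section IndependentSubsequence

open MeasureTheory Filter

variable {X : Type u} [MeasurableSpace X] {ν : Measure X} {f : ℕ → X → ℝ}

/-- If every non-null measurable subset of `D` is met by `{f n < a}` and by `{b < f n}` for almost
all `n` with respect to an ultrafilter, then `f` has a subsequence that is independent at the
levels `a` and `b`. -/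
theorem exists_subsequence_of_hereditarily_split (hf : ∀ n, Measurable (f n)) {D : Set X}
    (hDm : MeasurableSet D) (hD : ν D ≠ 0) {a b : ℝ}
    (h : ∀ D' ⊆ D, MeasurableSet D' → ν D' ≠ 0 →
      (∀ᶠ n in (hyperfilter ℕ : Filter ℕ), ν (D' ∩ {x | f n x < a}) ≠ 0) ∧
      ∀ᶠ n in (hyperfilter ℕ : Filter ℕ), ν (D' ∩ {x | b < f n x}) ≠ 0) :
    ∃ g : ℕ → ℕ, Function.Injective g ∧ ∀ P M : Finset ℕ, Disjoint P M →
      ∃ x, (∀ n ∈ P, f (g n) x < a) ∧ ∀ n ∈ M, b < f (g n) x := by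
  classical
  let atom : Finset ℕ → Finset ℕ → Set X := fun P M =>
    D ∩ ((⋂ n ∈ P, {x | f n x < a}) ∩ ⋂ n ∈ M, {x | b < f n x})
  have hatom : ∀ P M, MeasurableSet (atom P M) := fun P M =>
    hDm.inter ((Finset.measurableSet_biInter _ fun n _ => measurableSet_lt (hf n) measurable_const).inter
      (Finset.measurableSet_biInter _ fun n _ => measurableSet_lt measurable_const (hf n)))
  -- All `2^|S|` atoms are non-null. Since they are finitely many, one index, for almost all
  -- choices, splits every atom simultaneously.
  let good : Finset ℕ → Prop := fun S => ∀ P ⊆ S, ν (atom P (S \ P)) ≠ 0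
  have hstep : ∀ S, good S → ∃ n, n ∉ S ∧ good (insert n S) := by
    intro S hS
    have h1 : ∀ᶠ n in (hyperfilter ℕ : Filter ℕ), ∀ P ∈ S.powerset,
        ν (atom P (S \ P) ∩ {x | f n x < a}) ≠ 0 ∧ ν (atom P (S \ P) ∩ {x | b < f n x}) ≠ 0 := by
      rw [Filter.eventually_all_finset]
      intro P hP
      have := h (atom P (S \ P)) inter_subset_left (hatom _ _) (hS P (Finset.mem_powerset.1 hP))
      exact this.1.and this.2
    have h2 : ∀ᶠ n in (hyperfilter ℕ : Filter ℕ), n ∉ S :=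
      hyperfilter_le_cofinite S.finite_toSet.compl_mem_cofinite
    obtain ⟨n, hn, hnS⟩ := (h1.and h2).exists
    refine ⟨n, hnS, fun P hP => ?_⟩
    have hPS : P.erase n ⊆ S := by
      rw [← Finset.subset_insert_iff]
      exact hP
    obtain ⟨hlt, hgt⟩ := hn _ (Finset.mem_powerset.2 hPS)
    by_cases hnP : n ∈ P
    · refine fun h0 => hlt (measure_mono_null ?_ h0)
      rintro x ⟨⟨hxD, hx1, hx2⟩, hx3⟩
      simp only [mem_iInter] at hx1 hx2
      refine ⟨hxD, mem_iInter₂.2 fun m hm => ?_, mem_iInter₂.2 fun m hm => ?_⟩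
      · by_cases hmn : m = n
        · exact hmn ▸ hx3
        · exact hx1 m (Finset.mem_erase.2 ⟨hmn, hm⟩)
      · rw [Finset.mem_sdiff, Finset.mem_insert] at hm
        refine hx2 m (Finset.mem_sdiff.2 ⟨hm.1.resolve_left ?_, ?_⟩)
        · rintro rfl; exact hm.2 hnP
        · exact fun h => hm.2 (Finset.mem_of_mem_erase h)
    · refine fun h0 => hgt (measure_mono_null ?_ h0)
      rintro x ⟨⟨hxD, hx1, hx2⟩, hx3⟩
      simp only [mem_iInter] at hx1 hx2
      refine ⟨hxD, mem_iInter₂.2 fun m hm => ?_, mem_iInter₂.2 fun m hm => ?_⟩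
      · exact hx1 m (Finset.mem_erase.2 ⟨fun h => hnP (h ▸ hm), hm⟩)
      · rw [Finset.mem_sdiff, Finset.mem_insert] at hm
        obtain rfl | hmS := hm.1
        · exact hx3
        · exact hx2 m (Finset.mem_sdiff.2 ⟨hmS, fun h => hm.2 (Finset.mem_of_mem_erase h)⟩)
  choose! next hnext hgood using hstep
  let S : ℕ → Finset ℕ := fun k => Nat.rec ∅ (fun _ T => insert (next T) T) k
  have hS0 : good (S 0) := by
    intro P hP
    obtain rfl : P = ∅ := Finset.subset_empty.1 hP
    simpa [atom, S] using hD
  have hS : ∀ k, good (S k) := fun k => by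
    induction k with
    | zero => exact hS0
    | succ k ih => exact hgood _ ih
  let g : ℕ → ℕ := fun k => next (S k)
  have hmono : Monotone S := monotone_nat_of_le_succ fun k => Finset.subset_insert _ _
  have hmem : ∀ {i k}, i < k → g i ∈ S k := fun {i k} hik =>
    hmono (Nat.succ_le_of_lt hik) (Finset.mem_insert_self _ _)
  have hinj : Function.Injective g := by
    have hne : ∀ i k, i < k → g i ≠ g k := fun i k hik heq =>
      hnext (S k) (hS k) (show g k ∈ S k from heq ▸ hmem hik)
    intro i k heq
    by_contra hik
    rcases lt_or_gt_of_ne hik with hik | hik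
    · exact hne i k hik heq
    · exact hne k i hik heq.symm
  refine ⟨g, hinj, fun P M hPM => ?_⟩
  obtain ⟨k, hk⟩ : ∃ k, ∀ i ∈ P ∪ M, i < k :=
    ⟨(P ∪ M).sup id + 1, fun i hi => Nat.lt_succ_of_le (Finset.le_sup (f := id) hi)⟩
  have hsub : P.image g ⊆ S k := by
    intro n hn
    obtain ⟨i, hi, rfl⟩ := Finset.mem_image.1 hn
    exact hmem (hk i (Finset.mem_union_left _ hi))
  -- Every index of `S k` outside `g(P)` is required to be above `b`; by injectivity and
  -- disjointness these include `g(M)`.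
  obtain ⟨x, -, hx1, hx2⟩ := nonempty_of_measure_ne_zero (hS k _ hsub)
  simp only [mem_iInter] at hx1 hx2
  refine ⟨x, fun n hn => hx1 _ (Finset.mem_image_of_mem g hn), fun n hn => hx2 _ ?_⟩
  refine Finset.mem_sdiff.2 ⟨hmem (hk n (Finset.mem_union_right _ hn)), fun hc => ?_⟩
  obtain ⟨i, hi, hin⟩ := Finset.mem_image.1 hc
  exact Finset.disjoint_left.1 hPM hi (hinj hin ▸ hn)

/-- An exhaustion principle: if every non-null measurable set contains a non-null good set and good
sets are closed under finite unions, then good sets fill the space up to small measure. -/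
theorem exists_measure_compl_lt_of_exhaustion [IsFiniteMeasure ν] {good : Set X → Prop}
    (hmeas : ∀ D, good D → MeasurableSet D) (hempty : good ∅)
    (hunion : ∀ D D', good D → good D' → good (D ∪ D'))
    (h : ∀ D, MeasurableSet D → ν D ≠ 0 → ∃ D' ⊆ D, good D' ∧ ν D' ≠ 0) {ε : ENNReal}
    (hε : 0 < ε) : ∃ D, good D ∧ ν Dᶜ < ε := by
  obtain ⟨u, -, hu, hu'⟩ := exists_seq_tendsto_sSup (S := ν '' {D | good D}) ⟨_, ∅, hempty, rfl⟩
    (OrderTop.bddAbove _)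
  choose D hD hDu using hu'
  obtain rfl : (fun k => ν (D k)) = u := funext hDu
  set s := sSup (ν '' {D | good D}) with hs
  have hle : ∀ D, good D → ν D ≤ s := fun D hD => le_sSup ⟨D, hD, rfl⟩
  have hsfin : s ≠ ⊤ := by
    refine ne_top_of_le_ne_top (measure_ne_top ν univ) (sSup_le ?_)
    rintro _ ⟨D, -, rfl⟩
    exact measure_mono (subset_univ _)
  -- Otherwise a good non-null piece of the complement could be added to each `D k`, exceeding the
  -- supremum.
  have hnull : ν (⋃ k, D k)ᶜ = 0 := by
    by_contra hne
    obtain ⟨D', hD'sub, hD', hD'ne⟩ := h _ (MeasurableSet.iUnion fun k => hmeas _ (hD k)).compl hne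
    have h1 : ∀ k, ν (D k) + ν D' ≤ s := by
      intro k
      rw [← measure_union _ (hmeas _ hD')]
      · exact hle _ (hunion _ _ (hD k) hD')
      · exact disjoint_left.2 fun x hx hx' => hD'sub hx' (mem_iUnion.2 ⟨k, hx⟩)
    have h2 : s + ν D' ≤ s := le_of_tendsto' (hu.add_const _) h1
    have h3 : s + ν D' ≤ s + 0 := by rwa [add_zero]
    exact hD'ne (nonpos_iff_eq_zero.1 ((ENNReal.add_le_add_iff_left hsfin).1 h3))
  -- Only finite unions are good, so the full union is approximated by partial unions; this is why a
  -- small remainder is left.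
  have hacc : ∀ k, good (accumulate D k) := fun k => by
    induction k with
    | zero => simpa [accumulate] using hD 0
    | succ k ih => rw [accumulate_succ]; exact hunion _ _ ih (hD _)
  have ht : Tendsto (fun k => ν (accumulate D k)ᶜ) atTop (𝓝 (ν (⋂ k, (accumulate D k)ᶜ))) := by
    refine tendsto_measure_iInter_atTop (fun k => (hmeas _ (hacc k)).compl.nullMeasurableSet)
      (fun i j hij => compl_subset_compl.2 (monotone_accumulate hij)) ⟨0, measure_ne_top _ _⟩
  rw [← compl_iUnion, iUnion_accumulate, hnull] at ht
  obtain ⟨k, hk⟩ := (ht.eventually (gt_mem_nhds hε)).exists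
  exact ⟨_, hacc k, hk⟩

/-- Without independent subsequences, every non-null set contains a non-null set on which almost
all the functions take values in a common short interval. -/
theorem exists_subset_short_interval (hf : ∀ n, Measurable (f n))
    {C : ℝ} (hC : ∀ n x, |f n x| ≤ C)
    (h : ∀ a b : ℝ, a < b → ∀ D, MeasurableSet D → ν D ≠ 0 → ∃ D' ⊆ D, MeasurableSet D' ∧ ν D' ≠ 0 ∧
      ((∀ᶠ n in (hyperfilter ℕ : Filter ℕ), ν (D' ∩ {x | f n x < a}) = 0) ∨
        ∀ᶠ n in (hyperfilter ℕ : Filter ℕ), ν (D' ∩ {x | b < f n x}) = 0))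
    {D : Set X} (hDm : MeasurableSet D) (hD : ν D ≠ 0) (k : ℕ) :
    ∃ D' ⊆ D, MeasurableSet D' ∧ ν D' ≠ 0 ∧ ∃ p : ℝ, ∀ᶠ n in (hyperfilter ℕ : Filter ℕ),
      ∀ᵐ x ∂ν.restrict D', f n x ∈ Icc p (p + 2 * (C + 1) * (2 / 3) ^ k) := by
  have hC0 : 0 ≤ C := by
    obtain ⟨x, -⟩ := nonempty_of_measure_ne_zero hD
    exact (abs_nonneg _).trans (hC 0 x)
  induction k with
  | zero =>
    refine ⟨D, Subset.rfl, hDm, hD, -C, Eventually.of_forall fun n => ae_of_all _ fun x => ?_⟩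
    have := abs_le.1 (hC n x)
    exact ⟨this.1, by linarith [this.2]⟩
  | succ k ih =>
    obtain ⟨D₁, hD₁D, hD₁m, hD₁, p, hp⟩ := ih
    -- Using `C + 1` keeps the length positive even when `C = 0`.
    set l := 2 * (C + 1) * (2 / 3 : ℝ) ^ k with hl
    have hl0 : 0 < l := by positivity
    have hl' : 2 * (C + 1) * (2 / 3 : ℝ) ^ (k + 1) = 2 / 3 * l := by rw [hl]; ring
    -- Testing at the two trisection points removes the lower or the upper third, hence the factor
    -- `2 / 3`.
    obtain ⟨D₂, hD₂D, hD₂m, hD₂, h2⟩ := h (p + l / 3) (p + 2 / 3 * l) (by linarith) D₁ hD₁m hD₁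
    refine ⟨D₂, hD₂D.trans hD₁D, hD₂m, hD₂, ?_⟩
    rw [hl']
    have hp' : ∀ᶠ n in (hyperfilter ℕ : Filter ℕ), ∀ᵐ x ∂ν.restrict D₂, f n x ∈ Icc p (p + l) :=
      hp.mono fun n hn => ae_restrict_of_ae_restrict_of_subset hD₂D hn
    rcases h2 with h2 | h2
    · refine ⟨p + l / 3, ?_⟩
      filter_upwards [hp', h2] with n hn hn2
      have : ∀ᵐ x ∂ν.restrict D₂, ¬ f n x < p + l / 3 := by
        rw [ae_iff]
        simp only [not_not]
        rw [Measure.restrict_apply (measurableSet_lt (hf n) measurable_const), inter_comm]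
        exact hn2
      filter_upwards [hn, this] with x hx hx'
      exact ⟨not_lt.1 hx', by linarith [hx.2]⟩
    · refine ⟨p, ?_⟩
      filter_upwards [hp', h2] with n hn hn2
      have : ∀ᵐ x ∂ν.restrict D₂, ¬ p + 2 / 3 * l < f n x := by
        rw [ae_iff]
        simp only [not_not]
        rw [Measure.restrict_apply (measurableSet_lt measurable_const (hf n)), inter_comm]
        exact hn2
      filter_upwards [hn, this] with x hx hx'
      exact ⟨hx.1, not_lt.1 hx'⟩

/-- A bounded sequence that is separated in `L¹` of a finite measure has an independent
subsequence. -/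
theorem exists_independent_subsequence [IsFiniteMeasure ν] (hf : ∀ n, Measurable (f n))
    {C : ℝ} (hC : ∀ n x, |f n x| ≤ C) {ε : ℝ} (hε : 0 < ε)
    (hsep : ∀ n m, n ≠ m → ε ≤ ∫ x, |f n x - f m x| ∂ν) :
    ∃ g : ℕ → ℕ, Function.Injective g ∧ IsIndependentSequence fun n => f (g n) := by
  by_contra hno
  have h : ∀ a b : ℝ, a < b → ∀ D, MeasurableSet D → ν D ≠ 0 →
      ∃ D' ⊆ D, MeasurableSet D' ∧ ν D' ≠ 0 ∧
      ((∀ᶠ n in (hyperfilter ℕ : Filter ℕ), ν (D' ∩ {x | f n x < a}) = 0) ∨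
        ∀ᶠ n in (hyperfilter ℕ : Filter ℕ), ν (D' ∩ {x | b < f n x}) = 0) := by
    intro a b hab D hDm hD
    by_contra hcon
    -- For an ultrafilter, not being eventually null means being eventually non-null, so failure of
    -- the alternative below `D` is the hereditary splitting hypothesis.
    obtain ⟨g, hg, hind⟩ := exists_subsequence_of_hereditarily_split (ν := ν) (a := a) (b := b) hf
      hDm hD fun D' hD'D hD'm hD' =>
        ⟨Ultrafilter.eventually_not.2 fun hc => hcon ⟨D', hD'D, hD'm, hD', .inl hc⟩,
          Ultrafilter.eventually_not.2 fun hc => hcon ⟨D', hD'D, hD'm, hD', .inr hc⟩⟩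
    exact hno ⟨g, hg, a, b, hab, hind⟩
  have hX : Nonempty X := by
    by_contra hX
    rw [not_nonempty_iff] at hX
    have := hsep 0 1 (by simp)
    rw [integral_of_isEmpty] at this
    linarith
  have hC0 : 0 ≤ C := (abs_nonneg _).trans (hC 0 hX.some)
  -- The two terms bound the integral over a set where the functions are `η`-close and over a
  -- complement of measure less than `η`.
  obtain ⟨η, hη, hηε⟩ : ∃ η : ℝ, 0 < η ∧ η * ν.real univ + 2 * C * η < ε := by
    have hpos : 0 < ν.real univ + 2 * C + 1 := by positivity
    refine ⟨ε / (ν.real univ + 2 * C + 1), by positivity, ?_⟩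
    have : ε / (ν.real univ + 2 * C + 1) * (ν.real univ + 2 * C + 1) = ε := by field_simp
    have h0 : 0 < ε / (ν.real univ + 2 * C + 1) := by positivity
    nlinarith
  obtain ⟨k, hk⟩ : ∃ k : ℕ, 2 * (C + 1) * (2 / 3 : ℝ) ^ k < η := by
    obtain ⟨k, hk⟩ := exists_pow_lt_of_lt_one (show 0 < η / (2 * (C + 1)) by positivity)
      (show (2 / 3 : ℝ) < 1 by norm_num)
    refine ⟨k, ?_⟩
    rwa [lt_div_iff₀' (by positivity)] at hk
  -- Finite unions of good sets are good because finitely many ultrafilter members intersect in a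
  -- member.
  let good : Set X → Prop := fun D => MeasurableSet D ∧ ∃ U ∈ (hyperfilter ℕ : Filter ℕ),
    ∀ n ∈ U, ∀ m ∈ U, ∀ᵐ x ∂ν.restrict D, |f n x - f m x| ≤ η
  obtain ⟨D, ⟨hDm, U, hU, hUη⟩, hDc⟩ := exists_measure_compl_lt_of_exhaustion (ν := ν)
    (good := good) (ε := ENNReal.ofReal η) (fun D hD => hD.1)
    ⟨MeasurableSet.empty, univ, univ_mem, by simp⟩
    (by
      rintro D D' ⟨hD, U, hU, h⟩ ⟨hD', U', hU', h'⟩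
      refine ⟨hD.union hD', U ∩ U', inter_mem hU hU', fun n hn m hm => ?_⟩
      rw [ae_restrict_union_iff]
      exact ⟨h n hn.1 m hm.1, h' n hn.2 m hm.2⟩)
    (by
      intro D hDm hD
      obtain ⟨D', hD'D, hD'm, hD', p, hp⟩ := exists_subset_short_interval hf hC h hDm hD k
      refine ⟨D', hD'D, ⟨hD'm, _, hp, fun n hn m hm => ?_⟩, hD'⟩
      filter_upwards [hn, hm] with x hx hx'
      rw [abs_le]
      constructor <;> linarith [hx.1, hx.2, hx'.1, hx'.2])
    (by simpa using hη)
  have hUinf : U.Infinite := by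
    intro hfin
    exact (hyperfilter ℕ).compl_notMem_iff.2 hU
      (hyperfilter_le_cofinite hfin.compl_mem_cofinite)
  obtain ⟨n, hn, m, hm, hnm⟩ := hUinf.nontrivial
  have hint : Integrable (fun x => |f n x - f m x|) ν := by
    refine Integrable.of_bound ((hf n).sub (hf m)).abs.aestronglyMeasurable (2 * C)
      (ae_of_all _ fun x => ?_)
    rw [Real.norm_eq_abs, abs_abs]
    linarith [abs_sub (f n x) (f m x), hC n x, hC m x]
  have h1 : ∫ x in D, |f n x - f m x| ∂ν ≤ η * ν.real univ := by
    have h2 : ‖∫ x in D, |f n x - f m x| ∂ν‖ ≤ η * ν.real D := by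
      refine norm_setIntegral_le_of_norm_le_const_ae (measure_lt_top _ _) ?_
      filter_upwards [hUη n hn m hm] with x hx
      rwa [Real.norm_eq_abs, abs_abs]
    refine (le_abs_self _).trans (h2.trans ?_)
    exact mul_le_mul_of_nonneg_left (measureReal_mono (subset_univ _)) hη.le
  have h2 : ∫ x in Dᶜ, |f n x - f m x| ∂ν ≤ 2 * C * η := by
    have h3 : ‖∫ x in Dᶜ, |f n x - f m x| ∂ν‖ ≤ 2 * C * ν.real Dᶜ := by
      refine norm_setIntegral_le_of_norm_le_const_ae (measure_lt_top _ _) (ae_of_all _ fun x => ?_)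
      rw [Real.norm_eq_abs, abs_abs]
      linarith [abs_sub (f n x) (f m x), hC n x, hC m x]
    refine (le_abs_self _).trans (h3.trans (mul_le_mul_of_nonneg_left ?_ (by positivity)))
    exact (ENNReal.toReal_mono ENNReal.ofReal_ne_top hDc.le).trans_eq (ENNReal.toReal_ofReal hη.le)
  have := hsep n m hnm
  rw [← integral_add_compl hDm hint] at this
  linarith

end IndependentSubsequence

/-! ### Independence on the dual ball versus total boundedness in `L¹` -/

section TameFamilies

open MeasureTheory Filter

variable {K : Type u} [TopologicalSpace K]

/-- The functions dominating, on average over all sign patterns, families on which the functionals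
`φ N s` have average at least `c`. -/
def averageMinorants (φ : ∀ N : ℕ, Finset (Fin N) → WeakDual ℝ C(K, ℝ)) (c : ℝ) : Set C(K, ℝ) :=
  {g | ∃ N₀, ∀ N ≥ N₀, ∃ h : Finset (Fin N) → C(K, ℝ), (∀ s x, |h s x| ≤ g x) ∧
    ∑ _s : Finset (Fin N), c ≤ ∑ s, φ N s (h s)}

/-- Convexity is needed for Hahn–Banach separation. Asking for the estimate only for large `N` lets
two members be combined beyond the larger threshold. -/
theorem convex_averageMinorants (φ : ∀ N : ℕ, Finset (Fin N) → WeakDual ℝ C(K, ℝ)) (c : ℝ) :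
    Convex ℝ (averageMinorants φ c) := by
  rintro g₁ ⟨N₁, h₁⟩ g₂ ⟨N₂, h₂⟩ s t hs ht hst
  refine ⟨max N₁ N₂, fun N hN => ?_⟩
  obtain ⟨k₁, hk₁, hs₁⟩ := h₁ N ((le_max_left _ _).trans hN)
  obtain ⟨k₂, hk₂, hs₂⟩ := h₂ N ((le_max_right _ _).trans hN)
  refine ⟨fun r => s • k₁ r + t • k₂ r, fun r x => ?_, ?_⟩
  · change |s * k₁ r x + t * k₂ r x| ≤ s * g₁ x + t * g₂ x
    refine (abs_add_le _ _).trans ?_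
    rw [abs_mul, abs_mul, abs_of_nonneg hs, abs_of_nonneg ht]
    exact add_le_add (mul_le_mul_of_nonneg_left (hk₁ r x) hs)
      (mul_le_mul_of_nonneg_left (hk₂ r x) ht)
  · simp only [map_add, map_smul, smul_eq_mul, Finset.sum_add_distrib, ← Finset.mul_sum]
    have h3 : ∑ _s : Finset (Fin N), c =
        s * ∑ _s : Finset (Fin N), c + t * ∑ _s : Finset (Fin N), c := by
      rw [← add_mul, hst, one_mul]
    rw [h3]
    exact add_le_add (mul_le_mul_of_nonneg_left hs₁ hs) (mul_le_mul_of_nonneg_left hs₂ ht)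

/-- Toggling `n` pairs the sign patterns. In each pair one pattern separates `n` from `m` and
contributes at least `b - a`, so the average is at least half of that. -/
theorem abs_sub_mem_averageMinorants {φ : ∀ N : ℕ, Finset (Fin N) → WeakDual ℝ C(K, ℝ)}
    {f : ℕ → C(K, ℝ)} {a b : ℝ}
    (hlt : ∀ N s (i : Fin N), i ∉ s → φ N s (f i) < a)
    (hgt : ∀ N s (i : Fin N), i ∈ s → b < φ N s (f i)) {n m : ℕ} (hnm : n ≠ m) :
    |f n - f m| ∈ averageMinorants φ ((b - a) / 2) := by
  classical
  refine ⟨max n m + 1, fun N hN => ?_⟩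
  have hn : n < N := lt_of_lt_of_le (Nat.lt_succ_of_le (le_max_left _ _)) hN
  have hm : m < N := lt_of_lt_of_le (Nat.lt_succ_of_le (le_max_right _ _)) hN
  let i : Fin N := ⟨n, hn⟩
  let j : Fin N := ⟨m, hm⟩
  have hij : j ≠ i := fun h => hnm (congrArg Fin.val h).symm
  let d : C(K, ℝ) := f n - f m
  -- The sign is chosen so that the functional takes the value `|φ N s d|`.
  refine ⟨fun s => if 0 ≤ φ N s d then d else -d, fun s x => ?_, ?_⟩
  · change |(if 0 ≤ φ N s d then d else -d) x| ≤ |d x|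
    split_ifs
    · exact le_rfl
    · exact (abs_neg (d x)).le
  · have habs : ∀ s, φ N s (if 0 ≤ φ N s d then d else -d) = |φ N s d| := by
      intro s
      split_ifs with h
      · rw [abs_of_nonneg h]
      · rw [map_neg, abs_of_neg (not_le.1 h)]
    simp only [habs]
    let e : Equiv.Perm (Finset (Fin N)) :=
      Function.Involutive.toPerm (fun s => symmDiff s {i}) fun s => symmDiff_symmDiff_cancel_right {i} s
    have hsep : ∀ s : Finset (Fin N), (i ∈ s ∧ j ∉ s) ∨ (i ∉ s ∧ j ∈ s) → b - a ≤ |φ N s d| := by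
      intro s hs
      have hd : φ N s d = φ N s (f n) - φ N s (f m) := map_sub _ _ _
      rw [hd]
      rcases hs with ⟨h1, h2⟩ | ⟨h1, h2⟩
      · have h3 := hgt N s i h1
        have h4 := hlt N s j h2
        refine le_trans ?_ (le_abs_self _)
        simp only [i, j] at h3 h4
        linarith
      · have h3 := hlt N s i h1
        have h4 := hgt N s j h2
        refine le_trans ?_ (neg_le_abs _)
        simp only [i, j] at h3 h4
        linarith
    have hi : ∀ s, i ∈ e s ↔ i ∉ s := fun s => by
      change i ∈ symmDiff s {i} ↔ _
      simp [Finset.mem_symmDiff]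
    have hj : ∀ s, j ∈ e s ↔ j ∈ s := fun s => by
      change j ∈ symmDiff s {i} ↔ _
      simp [Finset.mem_symmDiff, hij]
    have hpair : ∀ s, b - a ≤ |φ N s d| + |φ N (e s) d| := by
      intro s
      by_cases h : (i ∈ s ∧ j ∉ s) ∨ (i ∉ s ∧ j ∈ s)
      · linarith [hsep s h, abs_nonneg (φ N (e s) d)]
      · have := hsep (e s) (by rw [hi, hj]; tauto)
        linarith [abs_nonneg (φ N s d)]
    have hsum := Finset.sum_le_sum fun s (_ : s ∈ (Finset.univ : Finset (Finset (Fin N)))) => hpair s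
    rw [Finset.sum_add_distrib, Equiv.sum_comp e fun s => |φ N s d|] at hsum
    rw [← Finset.sum_div]
    linarith

variable [CompactSpace K]

/-- If `g < c` everywhere, the dominated functions have norm below `c`, and functionals in the unit
ball cannot average `c` on them. -/
theorem exists_le_apply_of_mem_averageMinorants
    {φ : ∀ N : ℕ, Finset (Fin N) → WeakDual ℝ C(K, ℝ)} {c : ℝ} (hc : 0 < c)
    (hφ : ∀ N s, φ N s ∈ dualUnitBall K) {g : C(K, ℝ)} (hg : g ∈ averageMinorants φ c) :
    ∃ x, c ≤ g x := by
  by_contra! hlt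
  obtain ⟨N, h⟩ := hg
  obtain ⟨k, hk, hs⟩ := h N le_rfl
  refine absurd hs (not_le.2 (Finset.sum_lt_sum_of_nonempty Finset.univ_nonempty fun s _ => ?_))
  refine (le_abs_self _).trans_lt ((hφ N s (k s)).trans_lt ?_)
  rw [ContinuousMap.norm_lt_iff _ hc]
  exact fun x => (hk s x).trans_lt (hlt x)

variable [MeasurableSpace K] [BorelSpace K]

theorem dist_toLp_one (μ : Measure K) [IsFiniteMeasure μ] (f g : C(K, ℝ)) :
    dist (ContinuousMap.toLp 1 μ ℝ f) (ContinuousMap.toLp 1 μ ℝ g) = ∫ x, |f x - g x| ∂μ := by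
  rw [L1.dist_eq_integral_dist]
  refine integral_congr_ae ?_
  filter_upwards [ContinuousMap.coeFn_toLp (𝕜 := ℝ) (p := 1) μ f,
    ContinuousMap.coeFn_toLp (𝕜 := ℝ) (p := 1) μ g] with x hx hx'
  rw [hx, hx', Real.dist_eq]

variable [T2Space K]

/-- A sequence in `C(K)` that is independent on the dual unit ball is separated in `L¹(μ)` for some
finite measure `μ` on `K`. -/
theorem exists_measure_separated_of_independent {f : ℕ → C(K, ℝ)}
    (hf : IsIndependentSequence fun n (φ : dualUnitBall K) => (φ : WeakDual ℝ C(K, ℝ)) (f n)) :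
    ∃ μ : Measure K, IsFiniteMeasure μ ∧ ∃ ε : ℝ, 0 < ε ∧
      ∀ n m, n ≠ m → ε ≤ ∫ x, |f n x - f m x| ∂μ := by
  classical
  obtain ⟨a, b, hab, hf⟩ := hf
  have hex : ∀ (N : ℕ) (s : Finset (Fin N)), ∃ φ : dualUnitBall K,
      (∀ i ∉ s, (φ : WeakDual ℝ C(K, ℝ)) (f i) < a) ∧
      ∀ i ∈ s, b < (φ : WeakDual ℝ C(K, ℝ)) (f i) := by
    intro N s
    obtain ⟨φ, h1, h2⟩ := hf (sᶜ.map Fin.valEmbedding) (s.map Fin.valEmbedding)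
      ((Finset.disjoint_map _).2 disjoint_compl_left)
    exact ⟨φ, fun i hi => h1 _ (Finset.mem_map_of_mem _ (Finset.mem_compl.2 hi)),
      fun i hi => h2 _ (Finset.mem_map_of_mem _ hi)⟩
  choose φ hlt hgt using hex
  have hc : 0 < (b - a) / 2 := by linarith
  set c := (b - a) / 2
  let U : Set C(K, ℝ) := {g | ∀ x, g x < c}
  have hUconv : Convex ℝ U := by
    intro g hg g' hg' s t hs ht hst x
    change s * g x + t * g' x < c
    have h1 := hg x
    have h2 := hg' x
    rcases hs.eq_or_lt with rfl | hs
    · obtain rfl : t = 1 := by linarith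
      linarith
    · nlinarith
  have hUopen : IsOpen U := by
    have := ContinuousMap.isOpen_setOfPred_mapsTo (X := K) (Y := ℝ) isCompact_univ (isOpen_Iio (a := c))
    simpa [MapsTo, U] using this
  obtain ⟨Λ, u, hΛU, hΛY⟩ := geometric_hahn_banach_open hUconv hUopen
    (convex_averageMinorants (fun N s => (φ N s : WeakDual ℝ C(K, ℝ))) c)
    (disjoint_left.2 fun g hg hg' => by
      obtain ⟨x, hx⟩ := exists_le_apply_of_mem_averageMinorants hc (fun N s => (φ N s).2) hg'
      exact not_lt.2 hx (hg x))
  have hu : 0 < u := by simpa using hΛU 0 fun x => hc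
  have hpos : ∀ g : C(K, ℝ), 0 ≤ g → 0 ≤ Λ g := by
    intro g hg
    by_contra! hneg
    -- This negative multiple of `g` is nonpositive, hence in `U`, yet `Λ` takes the value `u`
    -- there.
    have := hΛU ((u / Λ g) • g) fun x => by
      change u / Λ g * g x < c
      have h1 : u / Λ g ≤ 0 := (div_neg_of_pos_of_neg hu hneg).le
      have h2 : 0 ≤ g x := hg x
      nlinarith
    rw [map_smul, smul_eq_mul, div_mul_cancel₀ _ hneg.ne] at this
    exact lt_irrefl _ this
  let Λ' : CompactlySupportedContinuousMap K ℝ →ₚ[ℝ] ℝ := PositiveLinearMap.mk₀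
    { toFun := fun g => Λ g.toContinuousMap
      map_add' := fun g h => map_add Λ g.toContinuousMap h.toContinuousMap
      map_smul' := fun r g => map_smul Λ r g.toContinuousMap } fun g hg => hpos _ hg
  refine ⟨RealRMK.rieszMeasure Λ', inferInstance, u, hu, fun n m hnm => ?_⟩
  have h1 := hΛY _ (abs_sub_mem_averageMinorants hlt hgt hnm)
  have h2 := RealRMK.integral_rieszMeasure Λ'
    (CompactlySupportedContinuousMap.continuousMapEquiv |f n - f m|)
  have h3 : Λ' (CompactlySupportedContinuousMap.continuousMapEquiv |f n - f m|) = Λ |f n - f m| := rfl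
  rw [h3] at h2
  rw [← h2] at h1
  exact h1

theorem TotallyBounded.exists_dist_lt {α : Type*} [PseudoMetricSpace α] {S : Set α}
    (hS : TotallyBounded S) {u : ℕ → α} (hu : ∀ n, u n ∈ S) {ε : ℝ} (hε : 0 < ε) :
    ∃ n m, n ≠ m ∧ dist (u n) (u m) < ε := by
  obtain ⟨t, ht, hSt⟩ := Metric.totallyBounded_iff.1 hS (ε / 2) (by linarith)
  have h : ∀ n, ∃ y ∈ t, dist (u n) y < ε / 2 := by
    intro n
    obtain ⟨y, hy, hn⟩ := mem_iUnion₂.1 (hSt (hu n))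
    exact ⟨y, hy, hn⟩
  choose y hy hd using h
  obtain ⟨n, -, m, -, hnm, heq⟩ := infinite_univ.exists_ne_map_eq_of_mapsTo (f := y)
    (fun n _ => hy n) ht
  refine ⟨n, m, hnm, ?_⟩
  have h1 := hd n
  have h2 := hd m
  rw [← heq] at h2
  linarith [dist_triangle_right (u n) (u m) (y n)]

theorem exists_separated_seq_of_not_totallyBounded {α : Type*} [PseudoMetricSpace α] {S : Set α}
    (hS : ¬ TotallyBounded S) : ∃ ε : ℝ, 0 < ε ∧ ∃ u : ℕ → α, (∀ n, u n ∈ S) ∧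
      ∀ n m, n ≠ m → ε ≤ dist (u n) (u m) := by
  classical
  rw [Metric.totallyBounded_iff] at hS
  push Not at hS
  obtain ⟨ε, hε, h⟩ := hS
  refine ⟨ε, hε, ?_⟩
  obtain ⟨u, hu, hu'⟩ := exists_seq_of_forall_finset_exists (fun x => x ∈ S)
    (fun x y => ε ≤ dist x y) fun s _ => by
      obtain ⟨y, hy, hys⟩ := not_subset.1 (h s s.finite_toSet)
      refine ⟨y, hy, fun x hx => ?_⟩
      by_contra! hlt
      exact hys (mem_iUnion₂.2 ⟨x, hx, by rwa [Metric.mem_ball, dist_comm]⟩)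
  refine ⟨u, hu, fun n m hnm => ?_⟩
  rcases lt_or_gt_of_ne hnm with h | h
  · exact hu' n m h
  · rw [dist_comm]
    exact hu' m n h

theorem totallyBounded_toLp_of_mem_tameClass {A : Set C(K, ℝ)} (hA : A ∈ tameClass K)
    (μ : Measure K) [IsFiniteMeasure μ] : TotallyBounded (ContinuousMap.toLp 1 μ ℝ '' A) := by
  by_contra hno
  obtain ⟨ε, hε, u, hu, hsep⟩ := exists_separated_seq_of_not_totallyBounded hno
  choose f hfA hfu using hu
  obtain ⟨⟨C, hC⟩, hind⟩ := hA
  obtain ⟨g, -, hg⟩ := exists_independent_subsequence (ν := μ) (f := fun n => f n)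
    (fun n => (f n).continuous.measurable) (fun n x => hC _ (mem_image_of_mem _ (hfA n)) x) hε
    (fun n m hnm => by rw [← dist_toLp_one, hfu, hfu]; exact hsep n m hnm)
  exact hind _ (fun n => mem_image_of_mem _ (hfA (g n))) hg

/-- Independence is excluded on the whole dual ball, not only on `K`; this extra strength yields
polar compatibility. -/
theorem not_isIndependentSequence_of_totallyBounded {A : Set C(K, ℝ)}
    (hA : ∀ (μ : Measure K) [IsFiniteMeasure μ],
      TotallyBounded (ContinuousMap.toLp 1 μ ℝ '' A)) {f : ℕ → C(K, ℝ)} (hf : ∀ n, f n ∈ A) :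
    ¬ IsIndependentSequence fun n (φ : dualUnitBall K) => (φ : WeakDual ℝ C(K, ℝ)) (f n) := by
  intro hind
  obtain ⟨μ, hμ, ε, hε, hsep⟩ := exists_measure_separated_of_independent hind
  obtain ⟨n, m, hnm, hlt⟩ := (hA μ).exists_dist_lt (fun n => mem_image_of_mem _ (hf n)) hε
  rw [dist_toLp_one] at hlt
  exact not_lt.2 (hsep n m hnm) hlt

end TameFamilies

/-! ### Tame families form a polarly compatible bornological class -/

section TameClass

open MeasureTheory

variable {K : Type u} [TopologicalSpace K]

theorem absConvex_bipolar (A : Set C(K, ℝ)) : AbsConvex ℝ (polarInSpace (polarInDual A)) := by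
  refine ⟨balanced_iff_smul_mem.2 fun {c} hc f hf φ hφ => ?_, convex_polarInSpace _⟩
  rw [map_smul, smul_eq_mul, abs_mul]
  exact mul_le_one₀ hc (abs_nonneg _) (hf φ hφ)

variable [CompactSpace K]

theorem exists_bound_iff_isBounded {A : Set C(K, ℝ)} :
    (∃ C : ℝ, ∀ f ∈ (fun f : C(K, ℝ) => (f : K → ℝ)) '' A, ∀ x, |f x| ≤ C) ↔
      Bornology.IsBounded A := by
  rw [isBounded_iff_forall_norm_le]
  constructor
  · rintro ⟨C, hC⟩
    refine ⟨max C 0, fun f hf => (ContinuousMap.norm_le _ (le_max_right _ _)).2 fun x => ?_⟩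
    exact (hC _ (mem_image_of_mem _ hf) x).trans (le_max_left _ _)
  · rintro ⟨C, hC⟩
    refine ⟨C, ?_⟩
    rintro _ ⟨f, hf, rfl⟩ x
    exact (f.norm_coe_le_norm x).trans (hC f hf)

variable [T2Space K]

/-- Tame families in `C(K)` are the bounded families that are totally bounded in `L¹(μ)` for all
finite measures `μ` on `K`. -/
theorem mem_tameClass_iff [MeasurableSpace K] [BorelSpace K] {A : Set C(K, ℝ)} :
    A ∈ tameClass K ↔ Bornology.IsBounded A ∧ ∀ (μ : Measure K) [IsFiniteMeasure μ],
      TotallyBounded (ContinuousMap.toLp (E := ℝ) 1 μ ℝ '' A) := by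
  refine ⟨fun hA => ⟨exists_bound_iff_isBounded.1 hA.1, fun μ _ =>
    totallyBounded_toLp_of_mem_tameClass hA μ⟩, fun ⟨hb, hA⟩ =>
    ⟨exists_bound_iff_isBounded.2 hb, fun f hf hind => ?_⟩⟩
  choose F hFA hFf using hf
  obtain rfl : (fun n => (F n : K → ℝ)) = f := funext hFf
  refine not_isIndependentSequence_of_totallyBounded hA hFA ?_
  obtain ⟨a, b, hab, h⟩ := hind
  refine ⟨a, b, hab, fun P M hPM => ?_⟩
  obtain ⟨x, hx⟩ := h P M hPM
  -- Points of `K` act as evaluations in the dual ball, so independence on `K` implies independence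
  -- there.
  exact ⟨⟨ContinuousMap.evalCLM ℝ x, fun g => g.norm_coe_le_norm x⟩, hx⟩

theorem isPolarlyCompatible_tameClass : IsPolarlyCompatible tameClass.{u} := by
  intro K _ _ _ A hA
  let _ : MeasurableSpace K := borel K
  have : BorelSpace K := ⟨rfl⟩
  obtain ⟨hb, hT⟩ := mem_tameClass_iff.1 hA
  constructor
  · obtain ⟨C, hC⟩ := isBounded_iff_forall_norm_le.1 hb
    refine ⟨C, ?_⟩
    rintro _ ⟨_, ⟨f, hf, rfl⟩, rfl⟩ φ
    exact (φ.2 f).trans (hC f hf)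
  · intro f hf hind
    choose F hFA hFf using hf
    choose G hGA hGF using hFA
    obtain rfl : (fun n => restrictionMap (dualUnitBall K) (G n)) = F := funext hGF
    obtain rfl : (fun n => (restrictionMap (dualUnitBall K) (G n) : dualUnitBall K → ℝ)) = f :=
      funext hFf
    exact not_isIndependentSequence_of_totallyBounded hT hGA hind

theorem subset_mem_tameClass {A B : Set C(K, ℝ)} (hA : A ∈ tameClass K) (hBA : B ⊆ A) :
    B ∈ tameClass K :=
  ⟨hA.1.imp fun _ hC f hf => hC f (image_mono hBA hf),
    fun f hf => hA.2 f fun n => image_mono hBA (hf n)⟩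

/-- Total boundedness in `L¹(μ)` passes to the closed absolutely convex hull, whose preimage under
the embedding is closed, absolutely convex and contains the family. -/
theorem bipolar_mem_tameClass {A : Set C(K, ℝ)} (hA : A ∈ tameClass K) :
    polarInSpace (polarInDual A) ∈ tameClass K := by
  let _ : MeasurableSpace K := borel K
  have : BorelSpace K := ⟨rfl⟩
  obtain ⟨hb, hT⟩ := mem_tameClass_iff.1 hA
  -- Adjoining zero makes the family nonempty, as the bipolar theorem requires.
  suffices h : closedAbsConvexHull ℝ (insert 0 A) ∈ tameClass K from
    subset_mem_tameClass h ((polarInSpace_anti (polarInDual_anti (subset_insert 0 A))).trans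
      (polarInSpace_polarInDual_subset_closedAbsConvexHull (insert_nonempty 0 A)))
  refine mem_tameClass_iff.2 ⟨?_, fun μ _ => ?_⟩
  · obtain ⟨C, hC⟩ := isBounded_iff_forall_norm_le.1 (hb.insert 0)
    refine Metric.isBounded_closedBall.subset (closedAbsConvexHull_min
      (t := Metric.closedBall 0 C) (fun f hf => mem_closedBall_zero_iff.2 (hC f hf))
      ⟨balanced_closedBall_zero, convex_closedBall _ _⟩ Metric.isClosed_closedBall)
  · set T := ContinuousMap.toLp (E := ℝ) 1 μ ℝ with hTdef
    have h1 : TotallyBounded (T '' insert 0 A) := by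
      rw [image_insert_eq, insert_eq]
      exact (totallyBounded_singleton _).union (hT μ)
    have h2 : TotallyBounded (closedAbsConvexHull ℝ (T '' insert 0 A)) := by
      rw [closedAbsConvexHull_eq_closure_absConvexHull]
      exact (totallyBounded_absConvexHull.2 h1).closure
    refine h2.subset (image_subset_iff.2 (closedAbsConvexHull_min ?_ ?_ ?_))
    · exact fun f hf => subset_closedAbsConvexHull (mem_image_of_mem T hf)
    · have hac : AbsConvex ℝ (closedAbsConvexHull ℝ (T '' insert 0 A)) := absConvex_convexClosedHull
      refine ⟨balanced_iff_smul_mem.2 fun {c} hc f hf => ?_, hac.2.linear_preimage T.toLinearMap⟩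
      rw [mem_preimage, map_smul]
      exact balanced_iff_smul_mem.1 hac.1 hc hf
    · exact isClosed_closedAbsConvexHull.preimage T.continuous

theorem union_mem_tameClass {A B : Set C(K, ℝ)} (hA : A ∈ tameClass K) (hB : B ∈ tameClass K) :
    A ∪ B ∈ tameClass K := by
  let _ : MeasurableSpace K := borel K
  have : BorelSpace K := ⟨rfl⟩
  rw [mem_tameClass_iff] at hA hB ⊢
  refine ⟨hA.1.union hB.1, fun μ _ => ?_⟩
  rw [image_union]
  exact (hA.2 μ).union (hB.2 μ)

theorem smul_mem_tameClass {A : Set C(K, ℝ)} (hA : A ∈ tameClass K) (c : ℝ) :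
    c • A ∈ tameClass K := by
  let _ : MeasurableSpace K := borel K
  have : BorelSpace K := ⟨rfl⟩
  rw [mem_tameClass_iff] at hA ⊢
  refine ⟨hA.1.smul₀ c, fun μ _ => ?_⟩
  have himg : ContinuousMap.toLp (E := ℝ) 1 μ ℝ '' (c • A) =
      c • (ContinuousMap.toLp (E := ℝ) 1 μ ℝ '' A) := by
    rw [← image_smul, ← image_smul, image_image, image_image]
    simp only [map_smul]
  rw [himg]
  exact (hA.2 μ).image (uniformContinuous_const_smul c)

/-- Writing `f + g` as twice the midpoint places `A + B` inside `2 • (A ∪ B)°°`. -/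
theorem add_mem_tameClass {A B : Set C(K, ℝ)} (hA : A ∈ tameClass K) (hB : B ∈ tameClass K) :
    A + B ∈ tameClass K := by
  refine subset_mem_tameClass (smul_mem_tameClass
    (bipolar_mem_tameClass (union_mem_tameClass hA hB)) 2) ?_
  rintro _ ⟨f, hf, g, hg, rfl⟩
  refine ⟨(1 / 2 : ℝ) • f + (1 / 2 : ℝ) • g, (absConvex_bipolar _).2
    (subset_polarInSpace_polarInDual _ (.inl hf)) (subset_polarInSpace_polarInDual _ (.inr hg))
    (by norm_num) (by norm_num) (by norm_num), ?_⟩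
  simp only [smul_add, smul_smul]
  norm_num

theorem singleton_mem_tameClass (f : C(K, ℝ)) : {f} ∈ tameClass K := by
  refine ⟨exists_bound_iff_isBounded.2 Bornology.isBounded_singleton, fun F hF => ?_⟩
  rintro ⟨a, b, hab, h⟩
  obtain ⟨x, h1, h2⟩ := h {0} {1} (by simp)
  have h3 : ∀ n, F n = f := fun n => by
    obtain ⟨g, rfl, hg⟩ := hF n
    exact hg.symm
  have h4 := h1 0 (by simp)
  have h5 := h2 1 (by simp)
  rw [h3] at h4 h5
  linarith

theorem isBornologicalClass_tameClass : IsBornologicalClass tameClass.{u} where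
  convexVectorBornology K _ _ _ :=
    { covers := eq_univ_of_forall fun f => ⟨{f}, singleton_mem_tameClass f, rfl⟩
      subset_mem := fun _ hA _ hBA => subset_mem_tameClass hA hBA
      union_mem := fun _ hA _ hB => union_mem_tameClass hA hB
      add_mem := fun _ hA _ hB => add_mem_tameClass hA hB
      smul_mem := fun c _ hA => smul_mem_tameClass hA c
      balancedHull_mem := fun A hA => subset_mem_tameClass (bipolar_mem_tameClass hA)
        ((absConvex_bipolar A).1.balancedHull_subset_of_subset (subset_polarInSpace_polarInDual A))
      convexHull_mem := fun A hA => subset_mem_tameClass (bipolar_mem_tameClass hA)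
        (convexHull_min (subset_polarInSpace_polarInDual A) (absConvex_bipolar A).2) }
  separated K _ _ _ S hS := by
    obtain ⟨C, hC⟩ := isBounded_iff_forall_norm_le.1 (exists_bound_iff_isBounded.1 hS.1)
    rw [Submodule.eq_bot_iff]
    intro f hf
    by_contra hne
    have hpos : 0 < ‖f‖ := norm_pos_iff.2 hne
    have h1 := hC _ (S.smul_mem ((|C| + 1) / ‖f‖) hf)
    rw [norm_smul, Real.norm_eq_abs, abs_of_pos (by positivity), div_mul_cancel₀ _ hpos.ne'] at h1
    linarith [le_abs_self C]
  bounded K _ _ _ A hA := exists_bound_iff_isBounded.1 hA.1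
  comp_mem K L _ _ _ _ _ _ α A hA := by
    constructor
    · obtain ⟨C, hC⟩ := hA.1
      refine ⟨C, ?_⟩
      rintro _ ⟨_, ⟨f, hf, rfl⟩, rfl⟩ x
      exact hC _ (mem_image_of_mem _ hf) (α x)
    · rintro F hF ⟨a, b, hab, h⟩
      choose G hGA hGF using hF
      choose H hHA hHG using hGA
      refine hA.2 (fun n => H n) (fun n => mem_image_of_mem _ (hHA n))
        ⟨a, b, hab, fun P M hPM => ?_⟩
      obtain ⟨x, hx⟩ := h P M hPM
      refine ⟨α x, ?_⟩
      simpa only [← hGF, ← hHG, ContinuousMap.comp_apply] using hx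
  mem_of_comp_mem K L _ _ _ _ _ _ α A hα hA := by
    constructor
    · obtain ⟨C, hC⟩ := hA.1
      refine ⟨C, ?_⟩
      rintro _ ⟨f, hf, rfl⟩ y
      obtain ⟨x, rfl⟩ := hα y
      exact hC _ ⟨f.comp α, mem_image_of_mem _ hf, rfl⟩ x
    · rintro F hF ⟨a, b, hab, h⟩
      choose G hGA hGF using hF
      refine hA.2 (fun n => (G n).comp α) (fun n => ⟨_, mem_image_of_mem _ (hGA n), rfl⟩)
        ⟨a, b, hab, fun P M hPM => ?_⟩
      obtain ⟨y, hy⟩ := h P M hPM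
      obtain ⟨x, rfl⟩ := hα y
      refine ⟨x, ?_⟩
      simpa only [← hGF, ContinuousMap.comp_apply] using hy
  bipolar_mem K _ _ _ A hA := bipolar_mem_tameClass hA

end TameClass

theorem theoremt {E : Type u} [AddCommGroup E] [Module ℝ E] (τ : TopologicalSpace E)
    [IsTopologicalAddGroup E] [ContinuousSMul ℝ E] [LocallyConvexSpace ℝ E] [T2Space E] :
    -- the tame topology
    (IsConvexVectorBornology (coSmall tameClass τ) ∧
      IsSaturatedBornology (coSmall tameClass τ) ∧
      (@nhds E (tameTopology τ) 0).HasBasis (fun M => M ∈ coSmall tameClass τ) polarInSpace ∧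
      @T2Space E (tameTopology τ) ∧
      IsStrongestSmallTopology tameClass τ (tameTopology τ) ∧
      tameTopology τ ≤ weakTopology τ ∧ τ ≤ tameTopology τ ∧ mackeyTopology τ ≤ τ) ∧
    -- the general case
    (∀ 𝔅 : FunctionClass.{u}, IsBornologicalClass 𝔅 → IsPolarlyCompatible 𝔅 →
      IsConvexVectorBornology (coSmall 𝔅 τ) ∧
      IsSaturatedBornology (coSmall 𝔅 τ) ∧
      (@nhds E (coSmallTopology 𝔅 τ) 0).HasBasis (fun M => M ∈ coSmall 𝔅 τ) polarInSpace ∧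
      @T2Space E (coSmallTopology 𝔅 τ) ∧
      IsStrongestSmallTopology 𝔅 τ (coSmallTopology 𝔅 τ) ∧
      coSmallTopology 𝔅 τ ≤ weakTopology τ ∧ τ ≤ coSmallTopology 𝔅 τ ∧
      mackeyTopology τ ≤ τ) := by
  exact ⟨coSmallTopology_properties τ isBornologicalClass_tameClass isPolarlyCompatible_tameClass,
    fun _ h𝔅 hp => coSmallTopology_properties τ h𝔅 hp⟩
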